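/- Let $k$ be a local field of characteristic zero, i.e. $k=\mathbb R$ or $\mathbb C$ with the usual absolute value, or a locally compact, non-trivially and non-archimedeanly valued field of characteristic zero. If $k$ is non-archimedean, all seminorms and norms below are understood to satisfy the strong triangle inequality. A locally convex $k$-vector space is a topological $k$-vector space whose topology is defined by a family of seminorms; a Fréchet space is a Hausdorff, metrizable, complete locally convex space. A continuous linear map $T:E\to F$ of Banach spaces is nuclear if there are $\varphi_n\in E^{*}$ and $y_n\in F$ with $T(x)=\sum_{n}\varphi_n(x)\,y_n$ for all $x\in E$, where $\sum_n\|\varphi_n\|\,\|y_n\|<\infty$ if $k$ is archimedean, and $\|\varphi_n\|\,\|y_n\|\to 0$ if $k$ is non-archimedean. A continuous linear map $V\to W$ of locally convex spaces is nuclear if it factors through continuous linear maps $V\to E\to F\to W$ with $E,F$ Banach spaces and $E\to F$ nuclear. For a continuous seminorm $p$ on $V$ let $\widehat V_p$ be the Hausdorff completion of $V$ with respect to $p$. The space $V$ is nuclear if for every continuous seminorm $p$ there is a continuous seminorm $q\ge p$ such that the canonical map $\widehat V_q\to\widehat V_p$ is nuclear (if $k$ is archimedean), respectively compact (if $k$ is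 non-archimedean). An (FN)-space is a nuclear Fréchet space; a (DFN)-space is a space topologically isomorphic to the strong dual of an (FN)-space. **Proposition.** Let $V$ be an (FN)-space and $W$ a (DFN)-space over $k$. Then: 1. every continuous linear map $f:V\to W$ is nuclear; 2. every continuous linear map $g:W\to V$ is nuclear. -/

import Mathlib

open Filter Topology

universe uk u v w

/-- A local field of characteristic zero together with its absolute value: a locally compact,
nontrivially normed field of characteristic zero which is either non-archimedean, or `ℝ` or `ℂ`
with the usual absolute value. -/
structure IsLocalFieldCharZero (k : Type uk) [NontriviallyNormedField k] : Prop where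
  charZero : CharZero k
  locallyCompact : LocallyCompactSpace k
  archimedean_or_not : IsRCLikeNormedField k ∨ IsUltrametricDist k

section Seminorms

variable {k : Type uk} [NontriviallyNormedField k] {E : Type u} [AddCommGroup E] [Module k E]

/-- The seminorms that define locally convex topologies: all seminorms if `k` is archimedean,
and the seminorms satisfying the strong triangle inequality if `k` is non-archimedean. -/
def Seminorm.IsAdmissible (p : Seminorm k E) : Prop :=
  IsUltrametricDist k → ∀ x y : E, p (x + y) ≤ max (p x) (p y)

/-- The vector space `E` endowed with the seminorm `p` (and with the topology it defines). -/
def SeminormSpace (_p : Seminorm k E) : Type u := E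

noncomputable instance (p : Seminorm k E) : SeminormedAddCommGroup (SeminormSpace p) :=
  p.toAddGroupSeminorm.toSeminormedAddCommGroup

noncomputable instance (p : Seminorm k E) : NormedSpace k (SeminormSpace p) where
  toModule := (inferInstance : Module k E)
  norm_smul_le a x := (map_smul_eq_mul p a (show E from x)).le

/-- The Banach space attached to a seminorm `p` on `E`: the (Hausdorff) completion of `E`
with respect to `p`. -/
abbrev LocalBanach (p : Seminorm k E) : Type u := UniformSpace.Completion (SeminormSpace p)

/-- For `p ≤ q`, the identity of `E` as a continuous map from `(E, q)` to `(E, p)`. -/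
noncomputable def SeminormSpace.incl {p q : Seminorm k E} (h : p ≤ q) :
    SeminormSpace q →L[k] SeminormSpace p :=
  LinearMap.mkContinuous
    ({ toFun := fun x => x
       map_add' := fun _ _ => rfl
       map_smul' := fun _ _ => rfl } : SeminormSpace q →ₗ[k] SeminormSpace p)
    1 (fun x => by rw [one_mul]; exact h (show E from x))

/-- For `p ≤ q`, the canonical map from the completion for `q` to the completion for `p`. -/
noncomputable def LocalBanach.link {p q : Seminorm k E} (h : p ≤ q) :
    LocalBanach q →L[k] LocalBanach p :=
  (SeminormSpace.incl h).completion

end Seminorms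

section NuclearMaps

variable {k : Type uk} [NontriviallyNormedField k]

/-- Nuclear operators between Banach spaces: `T x = ∑ φ n x • y n`, where `∑ ‖φ n‖ * ‖y n‖ < ∞` if
`k` is archimedean, and `‖φ n‖ * ‖y n‖ → 0` if `k` is non-archimedean; that is, `T` is in the
image of the completed projective tensor product of the dual of `E` with `F`. -/
def IsNuclearOperator {E : Type u} {F : Type v} [NormedAddCommGroup E] [NormedSpace k E]
    [NormedAddCommGroup F] [NormedSpace k F] (T : E →L[k] F) : Prop :=
  ∃ (φ : ℕ → StrongDual k E) (y : ℕ → F),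
    (IsUltrametricDist k → Tendsto (fun n => ‖φ n‖ * ‖y n‖) atTop (𝓝 0)) ∧
    (¬ IsUltrametricDist k → Summable fun n => ‖φ n‖ * ‖y n‖) ∧
    ∀ x, HasSum (fun n => φ n x • y n) (T x)

/-- A continuous linear map between locally convex spaces is nuclear if it factors as
`V → E → F → W` with continuous linear maps, where `E`, `F` are Banach spaces
(with ultrametric norms if `k` is non-archimedean) and `E → F` is a nuclear operator. -/
def IsNuclearMap {V : Type u} {W : Type v} [AddCommGroup V] [Module k V] [TopologicalSpace V]
    [AddCommGroup W] [Module k W] [TopologicalSpace W] (f : V →L[k] W) : Prop :=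
  ∃ (E : Type u) (_ : NormedAddCommGroup E) (_ : NormedSpace k E)
    (F : Type v) (_ : NormedAddCommGroup F) (_ : NormedSpace k F)
    (a : V →L[k] E) (T : E →L[k] F) (b : F →L[k] W),
    CompleteSpace E ∧ CompleteSpace F ∧
    (IsUltrametricDist k → IsUltrametricDist E ∧ IsUltrametricDist F) ∧
    IsNuclearOperator T ∧ f = b.comp (T.comp a)

end NuclearMaps

section Spaces

variable (k : Type uk) [NontriviallyNormedField k]

/-- The topology of `V` is defined by its continuous admissible seminorms. -/
def IsLocallyConvex (V : Type u) [AddCommGroup V] [Module k V] [TopologicalSpace V] : Prop :=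
  ∀ U ∈ 𝓝 (0 : V), ∃ p : Seminorm k V, Continuous p ∧ p.IsAdmissible ∧ {x | p x < 1} ⊆ U

/-- Nuclearity of a locally convex space: every continuous admissible seminorm `p` is
dominated by a continuous admissible seminorm `q` such that the canonical map between the
completions is nuclear (`k` archimedean), respectively compact (`k` non-archimedean). -/
def IsNuclearSpace (V : Type u) [AddCommGroup V] [Module k V] [TopologicalSpace V] : Prop :=
  ∀ p : Seminorm k V, Continuous p → p.IsAdmissible →
    ∃ (q : Seminorm k V) (h : p ≤ q), Continuous q ∧ q.IsAdmissible ∧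
      (IsUltrametricDist k → IsCompactOperator (LocalBanach.link h)) ∧
      (¬ IsUltrametricDist k → IsNuclearOperator (LocalBanach.link h))

/-- Fréchet spaces: complete, metrizable (that is, Hausdorff and first countable) locally convex
topological vector spaces. -/
structure IsFrechet (V : Type u) [AddCommGroup V] [Module k V] [UniformSpace V] : Prop where
  uniformAddGroup : IsUniformAddGroup V
  continuousSMul : ContinuousSMul k V
  locallyConvex : IsLocallyConvex k V
  t2 : T2Space V
  firstCountable : FirstCountableTopology V
  complete : CompleteSpace V

/-- (FN)-spaces: nuclear Fréchet spaces. -/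
structure IsFN (V : Type u) [AddCommGroup V] [Module k V] [UniformSpace V] : Prop where
  frechet : IsFrechet k V
  nuclear : IsNuclearSpace k V

/-- (DFN)-spaces: the spaces topologically isomorphic to the strong dual of an (FN)-space.
`StrongDual` carries the topology of uniform convergence on bounded sets. -/
def IsDFN (W : Type v) [AddCommGroup W] [Module k W] [TopologicalSpace W] : Prop :=
  ∃ (U : Type w) (_ : AddCommGroup U) (_ : Module k U) (_ : UniformSpace U),
    IsFN k U ∧ Nonempty (W ≃L[k] StrongDual k U)

end Spaces

/-!
A continuous map from a metrizable space `V` to a strong dual `U'` is bounded on a product of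
neighbourhoods of zero of `V` and `U`, since null sequences are bounded. Hence it factors through a
map from a local Banach space of `V` to a dual Banach space, and a nuclear linking map of `V` makes
it nuclear.

In the other direction, Mackey's countability condition for the bounded subsets of a metrizable
space `U` says that one continuous seminorm on `U'` controls any given sequence of continuous
seminorms. So a continuous map from `U'` to a Fréchet space `V` factors through a Banach space `E`,
and it remains to see that `G : E → V` is nuclear when `V` is an (FN)-space. Let `r 0 ≤ r 1 ≤ ...`
be seminorms defining the topology of `V`.

* If `k` is non-archimedean, the unit ball of `E` has totally bounded image for each `r m`, hence
  also for `sup c m * r m` when the weights `c m` decrease fast enough. So `G` factors through a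
  compact operator, and compact operators of ultrametric Banach spaces are nuclear: repeatedly split
  off a longest vector in the image of the unit ball, with a norming functional given by the
  ultrametric Hahn-Banach theorem.
* If `k` is archimedean, there are finite rank operators `P n` of nuclear norm at most one from
  `r (n + 1)` to `r n`, as close to the identity as we like. Since
  `(P (n + 1) - P n) G = (1 - P n) (P (n + 1) G) - P n ((1 - P (n + 1)) G)`, the nuclear norms of
  these differences are small, and `G = ∑ (P (n + 1) - P n) G` converges to a nuclear map.
-/

section UltrametricHahnBanach

variable {k : Type uk} [NontriviallyNormedField k] {E : Type u} [AddCommGroup E] [Module k E]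

-- Two balls of an ultrametric space that meet are nested, so compactness yields a common point.
theorem exists_forall_norm_sub_le_of_ultrametric [IsUltrametricDist k] [ProperSpace k]
    {p : Seminorm k E}
    (hp : ∀ x y, p (x + y) ≤ max (p x) (p y)) {f : E →ₗ.[k] k} (hf : ∀ z, ‖f z‖ ≤ p z) (y : E) :
    ∃ c : k, ∀ z : f.domain, ‖f z - c‖ ≤ p (z - y) := by
  let B (z : f.domain) : Set k := Metric.closedBall (f z) (p (z - y))
  have B_subset (z z' : f.domain) (h : p (z - y) ≤ p (z' - y)) : B z ⊆ B z' := by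
    have hdist : dist (f z) (f z') ≤ p (z' - y) := calc
      dist (f z) (f z') = ‖f (z - z')‖ := by rw [dist_eq_norm, f.map_sub]
      _ ≤ p ((z - y) + -(z' - y)) := (hf _).trans_eq (congrArg p (by simp))
      _ ≤ p (z' - y) := (hp _ _).trans (by rw [map_neg_eq_map, max_eq_right h])
    intro t ht
    exact (dist_triangle_max t (f z) (f z')).trans (max_le (ht.trans h) hdist)
  have B_directed : Directed (· ⊇ ·) B := fun z z' =>
    (le_total (p (z - y)) (p (z' - y))).elim
      (fun h => ⟨z, subset_rfl, B_subset z z' h⟩) fun h => ⟨z', B_subset z' z h, subset_rfl⟩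
  obtain ⟨c, hc⟩ := IsCompact.nonempty_iInter_of_directed_nonempty_isCompact_isClosed B B_directed
    (fun z => ⟨f z, Metric.mem_closedBall_self (apply_nonneg p _)⟩)
    (fun z => isCompact_closedBall _ _) (fun z => Metric.isClosed_closedBall)
  exact ⟨c, fun z => by
    simpa only [B, mem_closedBall_iff_norm'] using Set.mem_iInter.1 hc z⟩

theorem norm_supSpanSingleton_le {p : Seminorm k E} {f : E →ₗ.[k] k} (hf : ∀ z, ‖f z‖ ≤ p z)
    {y : E} (hy : y ∉ f.domain) {c : k} (hc : ∀ z : f.domain, ‖f z - c‖ ≤ p (z - y))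
    (z : (f.supSpanSingleton y c hy).domain) : ‖f.supSpanSingleton y c hy z‖ ≤ p z := by
  obtain ⟨z, hz⟩ := z
  obtain ⟨d, hd, w, hw, rfl⟩ := Submodule.mem_sup.1 hz
  obtain ⟨t, rfl⟩ := Submodule.mem_span_singleton.1 hw
  rw [LinearPMap.supSpanSingleton_apply_mk _ _ _ _ _ hd, RingHom.id_apply]
  rcases eq_or_ne t 0 with rfl | ht
  · simpa using hf ⟨d, hd⟩
  let d' : f.domain := -t⁻¹ • ⟨d, hd⟩
  calc ‖f ⟨d, hd⟩ + t • c‖ = ‖-t • (f d' - c)‖ := by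
        rw [f.map_smul, smul_sub, smul_smul, neg_mul_neg, mul_inv_cancel₀ ht, one_smul, neg_smul,
          sub_neg_eq_add]
    _ ≤ ‖-t‖ * p (d' - y) := by rw [norm_smul]; gcongr; exact hc d'
    _ = p (d + t • y) := by
        rw [← map_smul_eq_mul]
        simp [d', smul_sub, smul_smul, ht]

theorem exists_extension_of_ultrametric [IsUltrametricDist k] [ProperSpace k] {p : Seminorm k E}
    (hp : ∀ x y, p (x + y) ≤ max (p x) (p y)) (f : E →ₗ.[k] k) (hf : ∀ z, ‖f z‖ ≤ p z) :
    ∃ g : E →ₗ[k] k, (∀ z : f.domain, g z = f z) ∧ ∀ x, ‖g x‖ ≤ p x := by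
  let S : Set (E →ₗ.[k] k) := {g | ∀ z : g.domain, ‖g z‖ ≤ p z}
  have chain_bounded : ∀ c, c ⊆ S → IsChain (· ≤ ·) c → ∀ y ∈ c, ∃ ub ∈ S, ∀ z ∈ c, z ≤ ub := by
    intro c hcS hc y hy
    refine ⟨LinearPMap.sSup c hc.directedOn, ?_, fun _ => LinearPMap.le_sSup hc.directedOn⟩
    rintro ⟨z, hz⟩
    have domain_directed : DirectedOn (· ≤ ·) (LinearPMap.domain '' c) :=
      directedOn_image.2 (hc.directedOn.mono LinearPMap.domain_mono.monotone)
    obtain ⟨_, ⟨g, hgc, rfl⟩, hzg⟩ :=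
      (Submodule.mem_sSup_of_directed (Set.Nonempty.image _ ⟨y, hy⟩) domain_directed).1 hz
    rw [← (LinearPMap.le_sSup hc.directedOn hgc).2 (x := ⟨z, hzg⟩) rfl]
    exact hcS hgc ⟨z, hzg⟩
  obtain ⟨g, hfg, hgS, g_max⟩ := zorn_le_nonempty₀ S chain_bounded f hf
  have domain_eq_top (y : E) : y ∈ g.domain := by
    by_contra hy
    obtain ⟨c, hc⟩ := exists_forall_norm_sub_le_of_ultrametric hp hgS y
    have hle := g_max (y := g.supSpanSingleton y c hy) (norm_supSpanSingleton_le hgS hy hc)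
      (LinearPMap.left_le_sup _ _ _)
    exact hy (hle.1 (Submodule.mem_sup_right (Submodule.mem_span_singleton_self y)))
  exact ⟨g.toFun.comp (LinearMap.id.codRestrict g.domain domain_eq_top),
    fun z => (hfg.2 rfl).symm, fun x => hgS ⟨x, domain_eq_top x⟩⟩

theorem exists_dual_vector_of_ultrametric [IsUltrametricDist k] [ProperSpace k] {p : Seminorm k E}
    (hp : ∀ x y, p (x + y) ≤ max (p x) (p y)) {x : E} (hx : p x ≠ 0) :
    ∃ φ : E →ₗ[k] k, φ x = 1 ∧ ∀ z, ‖φ z‖ * p x ≤ p z := by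
  have hx_pos : 0 < p x := (apply_nonneg p x).lt_of_ne' hx
  have hx_ne : x ≠ 0 := fun h => hx (h ▸ map_zero p)
  let q : Seminorm k E := (p x).toNNReal⁻¹ • p
  have q_apply (z : E) : q z = p z / p x := by
    rw [smul_apply, NNReal.smul_def, NNReal.coe_inv, Real.coe_toNNReal _ hx_pos.le,
      smul_eq_mul, inv_mul_eq_div]
  have hq (y z : E) : q (y + z) ≤ max (q y) (q z) := by
    rw [q_apply, q_apply, q_apply, max_div_div_right hx_pos.le]
    exact div_le_div_of_nonneg_right (hp y z) hx_pos.le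
  let f : E →ₗ.[k] k := LinearPMap.mkSpanSingleton x (1 : k) hx_ne
  have hf (z : f.domain) : ‖f z‖ ≤ q z := by
    obtain ⟨z, hz⟩ := z
    obtain ⟨t, rfl⟩ := Submodule.mem_span_singleton.1 hz
    rw [LinearPMap.mkSpanSingleton'_apply, map_smul_eq_mul, q_apply, div_self hx]
    simp
  obtain ⟨φ, hφf, hφ⟩ := exists_extension_of_ultrametric hq f hf
  refine ⟨φ, ?_, fun z => ?_⟩
  · exact (hφf ⟨x, Submodule.mem_span_singleton_self x⟩).trans
      (LinearPMap.mkSpanSingleton_apply k k hx_ne (1 : k))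
  · rw [← le_div_iff₀ hx_pos, ← q_apply]
    exact hφ z

end UltrametricHahnBanach

section CompactOperators

variable {k : Type uk} [NontriviallyNormedField k]
  {E : Type u} [NormedAddCommGroup E] [NormedSpace k E]
  {F : Type v} [NormedAddCommGroup F] [NormedSpace k F]

/-- `S` attains its maximum on the unit ball at `x`, and `φ` is a norming functional at `x`: the
data needed to split the longest vector `S x` off the compact operator `S`. The last two conditions
say that passing to the residual operator does not leave the image of the unit ball, and that the
image of the residual operator is orthogonal to `S x` in the ultrametric sense. -/
structure IsMaximalSplitting (S : E →L[k] F) (x : E) (φ : StrongDual k E) : Prop where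
  norm_le_one : ‖x‖ ≤ 1
  norm_apply_le : ∀ z, ‖z‖ ≤ 1 → ‖S z‖ ≤ ‖S x‖
  norm_mul_norm_le : ∀ z, ‖φ z‖ * ‖S x‖ ≤ ‖S z‖
  norm_sub_le_one : ∀ z, ‖z‖ ≤ 1 → ‖z - φ z • x‖ ≤ 1
  norm_le_norm_sub : ∀ z, ‖S x‖ ≤ ‖S x - S (z - φ z • x)‖

/-- What remains of `S` after the rank one operator `z ↦ φ z • S x` has been split off. -/
noncomputable def rankOneResidual (S : E →L[k] F) (x : E) (φ : StrongDual k E) : E →L[k] F :=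
  S.comp (ContinuousLinearMap.id k E - φ.smulRight x)

theorem rankOneResidual_apply (S : E →L[k] F) (x : E) (φ : StrongDual k E) (z : E) :
    rankOneResidual S x φ z = S (z - φ z • x) := rfl

theorem exists_forall_norm_apply_le_of_isCompactOperator [IsUltrametricDist F] {S : E →L[k] F}
    (hS : IsCompactOperator S) : ∃ x, ‖x‖ ≤ 1 ∧ ∀ z, ‖z‖ ≤ 1 → ‖S z‖ ≤ ‖S x‖ := by
  have image_compact : IsCompact (closure (S '' Metric.closedBall 0 1)) :=
    hS.isCompact_closure_image_closedBall (f := (S : E →ₗ[k] F)) 1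
  have mem_image (z : E) (hz : ‖z‖ ≤ 1) : S z ∈ closure (S '' Metric.closedBall 0 1) :=
    subset_closure ⟨z, by simpa using hz, rfl⟩
  obtain ⟨m, hm, m_max⟩ :=
    image_compact.exists_isMaxOn ⟨S 0, mem_image 0 (by simp)⟩ continuous_norm.continuousOn
  rcases eq_or_ne m 0 with rfl | hm_ne
  · exact ⟨0, by simp, fun z hz => by simpa using m_max (mem_image z hz)⟩
  obtain ⟨_, ⟨x, hx, rfl⟩, hmx⟩ := Metric.mem_closure_iff.1 hm ‖m‖ (norm_pos_iff.2 hm_ne)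
  -- By the strong triangle inequality, a vector closer to `m` than `‖m‖` has the norm of `m`.
  have norm_m_le : ‖m‖ ≤ ‖S x‖ := by
    by_contra! hlt
    have h := IsUltrametricDist.norm_add_le_max (m - S x) (S x)
    rw [sub_add_cancel] at h
    exact h.not_gt (max_lt (by rwa [← dist_eq_norm]) hlt)
  exact ⟨x, by simpa using hx, fun z hz => (m_max (mem_image z hz)).trans norm_m_le⟩

theorem isMaximalSplitting_of_norming [IsUltrametricDist E] {S : E →L[k] F} {x : E}
    {φ : StrongDual k E} (hSx : S x ≠ 0) (hx : ‖x‖ ≤ 1) (x_max : ∀ z, ‖z‖ ≤ 1 → ‖S z‖ ≤ ‖S x‖)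
    (hφx : φ x = 1) (hφ : ∀ z, ‖φ z‖ * ‖S x‖ ≤ ‖S z‖) : IsMaximalSplitting S x φ where
  norm_le_one := hx
  norm_apply_le := x_max
  norm_mul_norm_le := hφ
  norm_sub_le_one z hz := by
    have hφz : ‖φ z‖ ≤ 1 := by
      have h := (hφ z).trans (x_max z hz)
      rwa [mul_le_iff_le_one_left (norm_pos_iff.2 hSx)] at h
    rw [sub_eq_add_neg]
    refine (IsUltrametricDist.norm_add_le_max _ _).trans (max_le hz ?_)
    rw [norm_neg, norm_smul]
    exact mul_le_one₀ hφz (norm_nonneg _) hx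
  norm_le_norm_sub z := by simpa [hφx] using hφ (x - (z - φ z • x))

theorem exists_isMaximalSplitting [IsUltrametricDist k] [ProperSpace k] [IsUltrametricDist E]
    [IsUltrametricDist F] {S : E →L[k] F} (hS : IsCompactOperator S) :
    ∃ x φ, IsMaximalSplitting S x φ := by
  obtain ⟨x, hx, x_max⟩ := exists_forall_norm_apply_le_of_isCompactOperator hS
  rcases eq_or_ne (S x) 0 with hSx | hSx
  · exact ⟨x, 0, hx, x_max, by simp, by simp, by simp [hSx]⟩
  let p : Seminorm k E := (normSeminorm k F).comp (S : E →ₗ[k] F)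
  have hp (y z : E) : p (y + z) ≤ max (p y) (p z) := by
    simpa [p] using IsUltrametricDist.norm_add_le_max (S y) (S z)
  obtain ⟨φ, hφx, hφ⟩ := exists_dual_vector_of_ultrametric hp (x := x) (norm_ne_zero_iff.2 hSx)
  let φ' : StrongDual k E := φ.mkContinuous (‖S‖ / ‖S x‖) fun z => by
    rw [div_mul_eq_mul_div, le_div_iff₀ (norm_pos_iff.2 hSx)]
    exact (hφ z).trans (S.le_opNorm z)
  exact ⟨x, φ', isMaximalSplitting_of_norming hSx hx x_max hφx hφ⟩

/-- The operators `R n` arise from `R 0` by successively splitting off the longest vectors. -/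
structure IsGreedySplitting (R : ℕ → E →L[k] F) (x : ℕ → E) (φ : ℕ → StrongDual k E) : Prop where
  splitting : ∀ n, IsMaximalSplitting (R n) (x n) (φ n)
  succ_eq : ∀ n, R (n + 1) = rankOneResidual (R n) (x n) (φ n)

theorem exists_isGreedySplitting [IsUltrametricDist k] [ProperSpace k] [IsUltrametricDist E]
    [IsUltrametricDist F] {T : E →L[k] F} (hT : IsCompactOperator T) :
    ∃ R x φ, IsGreedySplitting R x φ ∧ R 0 = T := by
  choose x φ splitting using fun S : {S : E →L[k] F // IsCompactOperator S} =>
    exists_isMaximalSplitting S.2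
  let R : ℕ → {S : E →L[k] F // IsCompactOperator S} :=
    Nat.rec ⟨T, hT⟩ fun _ S => ⟨rankOneResidual S.1 (x S) (φ S), S.2.comp_clm _⟩
  exact ⟨fun n => (R n).1, fun n => x (R n), fun n => φ (R n),
    ⟨fun n => splitting (R n), fun n => rfl⟩, rfl⟩

namespace IsGreedySplitting

variable {R : ℕ → E →L[k] F} {x : ℕ → E} {φ : ℕ → StrongDual k E}

theorem succ_apply (h : IsGreedySplitting R x φ) (n : ℕ) (z : E) :
    R (n + 1) z = R n z - φ n z • R n (x n) := by
  rw [h.succ_eq, rankOneResidual_apply, map_sub, map_smul]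

theorem exists_apply_eq (h : IsGreedySplitting R x φ) {n m : ℕ} (hnm : n ≤ m) (z : E) :
    ∃ w, (‖z‖ ≤ 1 → ‖w‖ ≤ 1) ∧ R m z = R n w := by
  induction m, hnm using Nat.le_induction generalizing z with
  | base => exact ⟨z, id, rfl⟩
  | succ m _ ih =>
    obtain ⟨w, hw, hRw⟩ := ih (z - φ m z • x m)
    exact ⟨w, fun hz => hw ((h.splitting m).norm_sub_le_one z hz), by
      rw [h.succ_eq, rankOneResidual_apply, hRw]⟩

theorem antitone_norm (h : IsGreedySplitting R x φ) : Antitone fun n => ‖R n (x n)‖ := by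
  intro n m hnm
  obtain ⟨w, hw, hRw⟩ := h.exists_apply_eq hnm (x m)
  simp only [hRw]
  exact (h.splitting n).norm_apply_le w (hw (h.splitting m).norm_le_one)

theorem norm_le_dist (h : IsGreedySplitting R x φ) {n m : ℕ} (hnm : n < m) :
    ‖R n (x n)‖ ≤ dist (R n (x n)) (R m (x m)) := by
  obtain ⟨w, -, hRw⟩ := h.exists_apply_eq (Nat.succ_le_of_lt hnm) (x m)
  rw [dist_eq_norm, hRw, h.succ_eq, rankOneResidual_apply]
  exact (h.splitting n).norm_le_norm_sub w

theorem tendsto_norm (h : IsGreedySplitting R x φ) (hR : IsCompactOperator (R 0)) :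
    Tendsto (fun n => ‖R n (x n)‖) atTop (𝓝 0) := by
  have image_compact : IsCompact (closure (R 0 '' Metric.closedBall 0 1)) :=
    hR.isCompact_closure_image_closedBall (f := (R 0 : E →ₗ[k] F)) 1
  have mem_image (n : ℕ) : R n (x n) ∈ closure (R 0 '' Metric.closedBall 0 1) := by
    obtain ⟨w, hw, hRw⟩ := h.exists_apply_eq (Nat.zero_le n) (x n)
    exact subset_closure ⟨w, by simpa using hw (h.splitting n).norm_le_one, hRw.symm⟩
  obtain ⟨a, -, s, hs, hsa⟩ := image_compact.tendsto_subseq mem_image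
  rw [Metric.tendsto_atTop]
  intro ε hε
  obtain ⟨N, hN⟩ := Metric.cauchySeq_iff.1 hsa.cauchySeq ε hε
  refine ⟨s N, fun n hn => ?_⟩
  rw [dist_zero_right, norm_norm]
  calc ‖R n (x n)‖ ≤ ‖R (s N) (x (s N))‖ := h.antitone_norm hn
    _ ≤ dist (R (s N) (x (s N))) (R (s (N + 1)) (x (s (N + 1)))) :=
      h.norm_le_dist (hs (Nat.lt_succ_self N))
    _ < ε := hN N le_rfl (N + 1) (Nat.le_succ N)

theorem norm_le (h : IsGreedySplitting R x φ) {c : k} (hc : 1 < ‖c‖) (n : ℕ) :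
    ‖R n‖ ≤ ‖c‖ * ‖R n (x n)‖ := by
  refine (R n).opNorm_le_of_shell one_pos (by positivity) hc fun z hz hz' => ?_
  have hc_pos : 0 < ‖c‖ := one_pos.trans hc
  calc ‖R n z‖ ≤ ‖R n (x n)‖ := (h.splitting n).norm_apply_le z hz'.le
    _ ≤ (‖c‖ * ‖z‖) * ‖R n (x n)‖ := by
      refine le_mul_of_one_le_left (norm_nonneg _) ?_
      rwa [mul_comm, ← div_le_iff₀ hc_pos]
    _ = ‖c‖ * ‖R n (x n)‖ * ‖z‖ := by ring

theorem norm_mul_norm_le (h : IsGreedySplitting R x φ) {c : k} (hc : 1 < ‖c‖) (n : ℕ) :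
    ‖φ n‖ * ‖R n (x n)‖ ≤ ‖c‖ * ‖R n (x n)‖ := by
  rw [← ContinuousLinearMap.norm_smulRight_apply]
  refine ((φ n).smulRight (R n (x n))).opNorm_le_bound (by positivity) fun z => ?_
  calc ‖φ n z • R n (x n)‖ = ‖φ n z‖ * ‖R n (x n)‖ := norm_smul _ _
    _ ≤ ‖R n z‖ := (h.splitting n).norm_mul_norm_le z
    _ ≤ ‖c‖ * ‖R n (x n)‖ * ‖z‖ := (R n).le_of_opNorm_le (h.norm_le hc n) z

theorem sum_range_add (h : IsGreedySplitting R x φ) (n : ℕ) (z : E) :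
    ∑ i ∈ Finset.range n, φ i z • R i (x i) + R n z = R 0 z := by
  induction n with
  | zero => simp
  | succ n ih => rw [← ih, Finset.sum_range_succ, h.succ_apply, add_assoc, add_sub_cancel]

end IsGreedySplitting

theorem isNuclearOperator_of_isCompactOperator [IsUltrametricDist k] [ProperSpace k]
    [IsUltrametricDist E] [IsUltrametricDist F] [CompleteSpace F] {T : E →L[k] F}
    (hT : IsCompactOperator T) : IsNuclearOperator T := by
  obtain ⟨R, x, φ, h, rfl⟩ := exists_isGreedySplitting hT
  obtain ⟨c, hc⟩ := NormedField.exists_one_lt_norm k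
  have hRx : Tendsto (fun n => ‖c‖ * ‖R n (x n)‖) atTop (𝓝 0) := by
    simpa using (h.tendsto_norm hT).const_mul ‖c‖
  have hφ : Tendsto (fun n => ‖φ n‖ * ‖R n (x n)‖) atTop (𝓝 0) :=
    squeeze_zero (fun n => by positivity) (h.norm_mul_norm_le hc) hRx
  have hR : Tendsto R atTop (𝓝 0) := squeeze_zero_norm (h.norm_le hc) hRx
  refine ⟨φ, fun n => R n (x n), fun _ => hφ, fun hk => (hk ‹_›).elim, fun z => ?_⟩
  have terms_tendsto : Tendsto (fun n => φ n z • R n (x n)) atTop (𝓝 0) := by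
    refine squeeze_zero_norm (fun n => ?_) (by simpa using hφ.mul_const ‖z‖)
    rw [norm_smul, mul_right_comm]
    gcongr
    exact (φ n).le_opNorm z
  have terms_summable : Summable fun n => φ n z • R n (x n) :=
    NonarchimedeanAddGroup.summable_of_tendsto_cofinite_zero (by rwa [Nat.cofinite_eq_atTop])
  have sums_tendsto :
      Tendsto (fun n => ∑ i ∈ Finset.range n, φ i z • R i (x i)) atTop (𝓝 (R 0 z)) := by
    have hRz : Tendsto (fun n => R n z) atTop (𝓝 0) :=
      ((ContinuousLinearMap.apply k F z).continuous.tendsto 0).comp hR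
    refine (sub_zero (R 0 z) ▸ tendsto_const_nhds.sub hRz).congr fun n => ?_
    rw [← h.sum_range_add n z, add_sub_cancel_right]
  exact (tendsto_nhds_unique terms_summable.hasSum.tendsto_sum_nat sums_tendsto) ▸
    terms_summable.hasSum

theorem IsNuclearOperator.clm_comp {G : Type w} [NormedAddCommGroup G] [NormedSpace k G]
    {T : E →L[k] F} (hT : IsNuclearOperator T) (S : F →L[k] G) :
    IsNuclearOperator (S.comp T) := by
  obtain ⟨φ, y, hnonarch, harch, hsum⟩ := hT
  have hle (n : ℕ) : ‖φ n‖ * ‖S (y n)‖ ≤ ‖S‖ * (‖φ n‖ * ‖y n‖) := by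
    rw [mul_left_comm]
    gcongr
    exact S.le_opNorm _
  refine ⟨φ, fun n => S (y n), fun h => ?_, fun h => ?_, fun x => ?_⟩
  · exact squeeze_zero (fun n => by positivity) hle (by simpa using (hnonarch h).const_mul ‖S‖)
  · exact Summable.of_nonneg_of_le (fun n => by positivity) hle ((harch h).mul_left ‖S‖)
  · simpa using (hsum x).mapL S

end CompactOperators

section LocalBanachSpaces

variable {k : Type uk} [NontriviallyNormedField k] {E : Type u} [AddCommGroup E] [Module k E]

/-- The identity of `E`, with values in `E` endowed with the seminorm `p`. -/
def SeminormSpace.of (p : Seminorm k E) : E ≃ₗ[k] SeminormSpace p := LinearEquiv.refl k E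

theorem SeminormSpace.norm_of (p : Seminorm k E) (x : E) : ‖SeminormSpace.of p x‖ = p x := rfl

/-- The canonical map from `E` to its completion with respect to a seminorm. -/
noncomputable def LocalBanach.of (p : Seminorm k E) : E →ₗ[k] LocalBanach p :=
  (UniformSpace.Completion.toComplL : SeminormSpace p →L[k] LocalBanach p).toLinearMap ∘ₗ
    (SeminormSpace.of p).toLinearMap

theorem LocalBanach.norm_of (p : Seminorm k E) (x : E) : ‖LocalBanach.of p x‖ = p x :=
  UniformSpace.Completion.norm_coe (SeminormSpace.of p x)

theorem LocalBanach.denseRange_of (p : Seminorm k E) : DenseRange (LocalBanach.of p) :=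
  UniformSpace.Completion.denseRange_coe (α := SeminormSpace p)

theorem LocalBanach.link_of {p q : Seminorm k E} (h : p ≤ q) (x : E) :
    LocalBanach.link h (LocalBanach.of q x) = LocalBanach.of p x :=
  (SeminormSpace.incl h).completion_apply_coe (SeminormSpace.of q x)

theorem LocalBanach.isUltrametricDist [IsUltrametricDist k] {p : Seminorm k E}
    (hp : p.IsAdmissible) : IsUltrametricDist (LocalBanach p) := by
  refine IsUltrametricDist.isUltrametricDist_of_forall_norm_add_le_max_norm fun x y => ?_
  refine (LocalBanach.denseRange_of p).induction_on₂
    (isClosed_le (by fun_prop) (by fun_prop)) (fun a b => ?_) x y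
  rw [← map_add, LocalBanach.norm_of, LocalBanach.norm_of, LocalBanach.norm_of]
  exact hp ‹_› a b

section Topology

variable [TopologicalSpace E] [IsTopologicalAddGroup E]

/-- The identity of `E` as a continuous linear map to `E` endowed with a continuous seminorm. -/
def SeminormSpace.mk (p : Seminorm k E) (hp : Continuous p) : E →L[k] SeminormSpace p where
  toLinearMap := (SeminormSpace.of p).toLinearMap
  cont := continuous_of_continuousAt_zero (SeminormSpace.of p) <| by
    rw [ContinuousAt, map_zero, tendsto_zero_iff_norm_tendsto_zero]
    simpa only [SeminormSpace.norm_of, map_zero] using hp.tendsto 0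

/-- The canonical map from `E` to its completion with respect to a continuous seminorm, as a
continuous linear map. -/
noncomputable def LocalBanach.mk (p : Seminorm k E) (hp : Continuous p) : E →L[k] LocalBanach p :=
  UniformSpace.Completion.toComplL.comp (SeminormSpace.mk p hp)

theorem LocalBanach.mk_apply (p : Seminorm k E) (hp : Continuous p) (x : E) :
    LocalBanach.mk p hp x = LocalBanach.of p x := rfl

end Topology

section Lift

variable {H : Type v} [AddCommGroup H] [Module k H] [UniformSpace H] [IsUniformAddGroup H]

/-- A linear map on `E` as a continuous linear map on `E` endowed with the seminorm `p`, when `p`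
controls its composites with the members of a family of seminorms defining the topology of the
target. -/
noncomputable def SeminormSpace.lift {ι : Type*} {r : ι → Seminorm k H}
    (hr : ∀ X ∈ 𝓝 (0 : H), ∃ i, {x | r i x < 1} ⊆ X) (p : Seminorm k E) (f : E →ₗ[k] H)
    (hf : ∀ i, ∃ C, ∀ x, r i (f x) ≤ C * p x) : SeminormSpace p →L[k] H where
  toLinearMap := f ∘ₗ (SeminormSpace.of p).symm.toLinearMap
  cont := by
    refine continuous_of_continuousAt_zero (f ∘ₗ (SeminormSpace.of p).symm.toLinearMap) ?_
    rw [ContinuousAt, map_zero]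
    intro X hX
    obtain ⟨i, hi⟩ := hr X hX
    obtain ⟨C, hC⟩ := hf i
    have small : ∀ᶠ x : SeminormSpace p in 𝓝 0, C * ‖x‖ < 1 :=
      (continuous_const.mul continuous_norm).continuousAt.eventually_lt_const (by simp)
    exact small.mono fun x hx => hi ((hC _).trans_lt hx)

variable [ContinuousConstSMul k H] [T0Space H] [CompleteSpace H]

/-- The extension to the completion of a linear map which is continuous for the seminorm `p`. -/
noncomputable def LocalBanach.extend {p : Seminorm k E} (f : SeminormSpace p →L[k] H) :
    LocalBanach p →L[k] H :=
  f.extend (UniformSpace.Completion.toComplL : SeminormSpace p →L[k] LocalBanach p)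

theorem LocalBanach.extend_of {p : Seminorm k E} (f : SeminormSpace p →L[k] H) (x : E) :
    LocalBanach.extend f (LocalBanach.of p x) = f (SeminormSpace.of p x) :=
  f.extend_eq UniformSpace.Completion.denseRange_coe
    (UniformSpace.Completion.isUniformInducing_coe _) (SeminormSpace.of p x)

end Lift

theorem seminorm_le_mul_of_forall_lt_one (p q : Seminorm k E) {c : k} (hc : 1 < ‖c‖) {M : ℝ}
    (h : ∀ x, q x < 1 → p x ≤ M) (x : E) : p x ≤ ‖c‖ * M * q x := by
  have hM : 0 ≤ M := by simpa using h 0 (by simp)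
  have hc_pos : 0 < ‖c‖ := one_pos.trans hc
  rcases eq_or_ne (q x) 0 with hqx | hqx
  · rw [hqx, mul_zero]
    by_contra! hpx
    obtain ⟨t, ht⟩ := NormedField.exists_lt_norm k (M / p x)
    refine (h (t • x) (by simp [map_smul_eq_mul, hqx])).not_gt ?_
    rwa [map_smul_eq_mul, ← div_lt_iff₀ hpx]
  · refine q.bound_of_shell p one_pos hc (fun y hy hy' => ?_) hqx
    calc p y ≤ M := h y hy'
      _ ≤ (‖c‖ * q y) * M := by
        refine le_mul_of_one_le_left hM ?_
        rwa [mul_comm, ← div_le_iff₀ hc_pos]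
      _ = ‖c‖ * M * q y := by ring

end LocalBanachSpaces

theorem IsNuclearSpace.exists_isNuclearOperator_link {k : Type uk} [NontriviallyNormedField k]
    [ProperSpace k] {V : Type u} [AddCommGroup V] [Module k V] [TopologicalSpace V]
    (hV : IsNuclearSpace k V) {p : Seminorm k V} (hp : Continuous p) (hpa : p.IsAdmissible) :
    ∃ (q : Seminorm k V) (h : p ≤ q), Continuous q ∧ q.IsAdmissible ∧
      IsNuclearOperator (LocalBanach.link h) := by
  obtain ⟨q, hpq, hq, hqa, hcompact, hnuclear⟩ := hV p hp hpa
  refine ⟨q, hpq, hq, hqa, ?_⟩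
  by_cases hk : IsUltrametricDist k
  · have := LocalBanach.isUltrametricDist hpa
    have := LocalBanach.isUltrametricDist hqa
    exact isNuclearOperator_of_isCompactOperator (hcompact hk)
  · exact hnuclear hk

section NuclearMapConstructions

variable {k : Type uk} [NontriviallyNormedField k]

theorem isUltrametricDist_of_isometry {X Y : Type*} [PseudoMetricSpace X] [PseudoMetricSpace Y]
    [IsUltrametricDist Y] {f : X → Y} (hf : Isometry f) : IsUltrametricDist X :=
  ⟨fun x y z => by simpa only [hf.dist_eq] using dist_triangle_max (f x) (f y) (f z)⟩

theorem strongDual_isUltrametricDist [IsUltrametricDist k] (G : Type w) [SeminormedAddCommGroup G]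
    [NormedSpace k G] : IsUltrametricDist (StrongDual k G) :=
  IsUltrametricDist.isUltrametricDist_of_forall_norm_add_le_max_norm fun φ ψ => by
    refine ContinuousLinearMap.opNorm_le_bound _ (by positivity) fun x => ?_
    calc ‖φ x + ψ x‖ ≤ max ‖φ x‖ ‖ψ x‖ := IsUltrametricDist.norm_add_le_max _ _
      _ ≤ max (‖φ‖ * ‖x‖) (‖ψ‖ * ‖x‖) := max_le_max (φ.le_opNorm x) (ψ.le_opNorm x)
      _ = max ‖φ‖ ‖ψ‖ * ‖x‖ := (max_mul_of_nonneg _ _ (norm_nonneg x)).symm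

noncomputable instance {E : Type u} [AddCommGroup E] [Module k E] (p : Seminorm k E) :
    NormedAddCommGroup (StrongDual k (SeminormSpace p)) :=
  NormedAddCommGroup.ofSeparation fun φ hφ => by
    ext x
    simpa [hφ] using φ.le_opNorm x

/-- The canonical linear isometry from a normed space to its copy in another universe. -/
noncomputable def shrinkLinearIsometryEquiv (k : Type uk) [NontriviallyNormedField k] (F : Type w)
    [Small.{v} F] [NormedAddCommGroup F] [NormedSpace k F] : Shrink.{v} F ≃ₗᵢ[k] F where
  toLinearEquiv := Shrink.linearEquiv k F
  norm_map' _ := rfl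

-- Injectivity of `b` makes `F` small, so that it has a copy in the universe of `W`.
theorem isNuclearMap_comp_of_injective {V : Type u} [AddCommGroup V] [Module k V]
    [TopologicalSpace V] {W : Type v} [AddCommGroup W] [Module k W] [TopologicalSpace W]
    {E : Type u} [NormedAddCommGroup E] [NormedSpace k E] [CompleteSpace E]
    {F : Type w} [NormedAddCommGroup F] [NormedSpace k F] [CompleteSpace F]
    (hultra : IsUltrametricDist k → IsUltrametricDist E ∧ IsUltrametricDist F) (a : V →L[k] E)
    {T : E →L[k] F} (hT : IsNuclearOperator T) {b : F →L[k] W} (hb : Function.Injective b) :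
    IsNuclearMap (b.comp (T.comp a)) := by
  have : Small.{v} F := small_of_injective hb
  let j : Shrink.{v} F ≃ₗᵢ[k] F := shrinkLinearIsometryEquiv k F
  refine ⟨E, inferInstance, inferInstance, Shrink.{v} F, inferInstance, inferInstance, a,
    (j.symm : F →L[k] Shrink.{v} F).comp T, b.comp (j : Shrink.{v} F →L[k] F), inferInstance,
    ?_, fun hk => ?_, hT.clm_comp _, ?_⟩
  · exact (completeSpace_congr (e := j.toEquiv) j.toContinuousLinearEquiv.isUniformEmbedding).2
      inferInstance
  · obtain ⟨hE, hF⟩ := hultra hk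
    exact ⟨hE, isUltrametricDist_of_isometry j.isometry⟩
  · ext x
    simp

theorem IsNuclearMap.comp_right {V V' : Type u} [AddCommGroup V] [Module k V] [TopologicalSpace V]
    [AddCommGroup V'] [Module k V'] [TopologicalSpace V'] {W : Type v} [AddCommGroup W]
    [Module k W] [TopologicalSpace W] {f : V' →L[k] W} (hf : IsNuclearMap f) (g : V →L[k] V') :
    IsNuclearMap (f.comp g) := by
  obtain ⟨E, _, _, F, _, _, a, T, b, hE, hF, hultra, hT, rfl⟩ := hf
  exact ⟨E, _, _, F, _, _, a.comp g, T, b, hE, hF, hultra, hT, rfl⟩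

end NuclearMapConstructions

section MapsToDual

/-- The seminorm `φ ↦ ‖φ u‖` on the dual space. -/
noncomputable def evalSeminorm (k : Type uk) [NontriviallyNormedField k] {U : Type w}
    [AddCommGroup U] [Module k U] [TopologicalSpace U] (u : U) : Seminorm k (StrongDual k U) :=
  (normSeminorm k k).comp (LinearMap.applyₗ u ∘ₗ ContinuousLinearMap.coeLM k)

variable {k : Type uk} [NontriviallyNormedField k] {V : Type u} [AddCommGroup V] [Module k V]
  [TopologicalSpace V] [FirstCountableTopology V] {U : Type w} [AddCommGroup U] [Module k U]
  [TopologicalSpace U] [IsTopologicalAddGroup U] [ContinuousSMul k U] [FirstCountableTopology U]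

-- A null sequence in `U` is bounded, hence null sequences in `V` go to zero uniformly on it.
theorem exists_nhds_norm_apply_le_one (f : V →L[k] StrongDual k U) :
    ∃ A ∈ 𝓝 (0 : V), ∃ B ∈ 𝓝 (0 : U), ∀ x ∈ A, ∀ y ∈ B, ‖f x y‖ ≤ 1 := by
  obtain ⟨A, hA⟩ := (𝓝 (0 : V)).exists_antitone_basis
  obtain ⟨B, hB⟩ := (𝓝 (0 : U)).exists_antitone_basis
  by_contra! hcon
  choose x hx y hy hxy using fun n =>
    hcon (A n) (hA.1.mem_of_mem trivial) (B n) (hB.1.mem_of_mem trivial)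
  have y_bounded : Bornology.IsVonNBounded k (Set.range y) := by
    let _ := IsTopologicalAddGroup.rightUniformSpace U
    have := isUniformAddGroup_of_addCommGroup (G := U)
    exact (hB.tendsto hy).isVonNBounded_range k
  have uniform_nhds : {φ : StrongDual k U | ∀ u ∈ Set.range y, φ u ∈ Metric.ball (0 : k) 1} ∈
      𝓝 (0 : StrongDual k U) :=
    ContinuousLinearMap.hasBasis_nhds_zero.mem_of_mem (i := (Set.range y, Metric.ball (0 : k) 1))
      ⟨y_bounded, Metric.ball_mem_nhds _ one_pos⟩
  have fx_tendsto : Tendsto (fun n => f (x n)) atTop (𝓝 0) :=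
    (map_zero f ▸ f.continuous.tendsto 0).comp (hA.tendsto hx)
  obtain ⟨n, hn⟩ := (fx_tendsto.eventually_mem uniform_nhds).exists
  exact (hxy n).not_gt (mem_ball_zero_iff.1 (hn (y n) ⟨n, rfl⟩))

theorem exists_seminorms_norm_apply_le (hV : IsLocallyConvex k V) (hU : IsLocallyConvex k U)
    (f : V →L[k] StrongDual k U) :
    ∃ (p : Seminorm k V) (r : Seminorm k U) (C : ℝ), Continuous p ∧ p.IsAdmissible ∧
      Continuous r ∧ ∀ x y, ‖f x y‖ ≤ C * p x * r y := by
  obtain ⟨A, hA, B, hB, hAB⟩ := exists_nhds_norm_apply_le_one f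
  obtain ⟨p, hp, hpa, hpA⟩ := hV A hA
  obtain ⟨r, hr, -, hrB⟩ := hU B hB
  obtain ⟨c, hc⟩ := NormedField.exists_one_lt_norm k
  have bound_right (x : V) (hx : p x < 1) (y : U) : ‖f x y‖ ≤ ‖c‖ * 1 * r y :=
    seminorm_le_mul_of_forall_lt_one ((normSeminorm k k).comp (f x).toLinearMap) r hc
      (fun y hy => hAB x (hpA hx) y (hrB hy)) y
  refine ⟨p, r, ‖c‖ * ‖c‖, hp, hpa, hr, fun x y => ?_⟩
  calc ‖f x y‖ ≤ ‖c‖ * (‖c‖ * 1 * r y) * p x :=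
        seminorm_le_mul_of_forall_lt_one ((evalSeminorm k y).comp f.toLinearMap) p hc
          (fun x hx => bound_right x hx y) x
    _ = ‖c‖ * ‖c‖ * p x * r y := by ring

theorem isNuclearMap_of_equiv_strongDual [IsTopologicalAddGroup V] [ProperSpace k]
    (hV : IsLocallyConvex k V) (hVn : IsNuclearSpace k V) (hU : IsLocallyConvex k U)
    {W : Type v} [AddCommGroup W] [Module k W] [TopologicalSpace W] (e : W ≃L[k] StrongDual k U)
    (f : V →L[k] W) : IsNuclearMap f := by
  obtain ⟨p, r, C, hp, hpa, hr, hC⟩ :=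
    exists_seminorms_norm_apply_le hV hU ((e : W →L[k] StrongDual k U).comp f)
  obtain ⟨q, hpq, hq, hqa, link_nuclear⟩ := hVn.exists_isNuclearOperator_link hp hpa
  let S : SeminormSpace p →L[k] StrongDual k (SeminormSpace r) :=
    LinearMap.mkContinuous₂ ((ContinuousLinearMap.coeLM k ∘ₗ e.toLinearMap ∘ₗ f.toLinearMap).compl₁₂
      (SeminormSpace.of p).symm.toLinearMap (SeminormSpace.of r).symm.toLinearMap) C
      fun x y => hC _ _
  let b : StrongDual k (SeminormSpace r) →L[k] W :=
    (e.symm : StrongDual k U →L[k] W).comp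
      (ContinuousLinearMap.precomp k (SeminormSpace.mk r hr))
  have b_injective : Function.Injective b :=
    e.symm.injective.comp fun ψ ψ' h => ContinuousLinearMap.ext fun y => DFunLike.congr_fun h y
  have f_eq : f = b.comp (((LocalBanach.extend S).comp (LocalBanach.link hpq)).comp
      (LocalBanach.mk q hq)) := by
    ext x
    apply e.injective
    ext y
    calc e (f x) y = S (SeminormSpace.of p x) (SeminormSpace.of r y) := rfl
      _ = LocalBanach.extend S (LocalBanach.link hpq (LocalBanach.of q x))
            (SeminormSpace.of r y) := by rw [LocalBanach.link_of, LocalBanach.extend_of]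
      _ = e (e.symm _) y := by rw [e.apply_symm_apply]; rfl
  rw [f_eq]
  refine isNuclearMap_comp_of_injective (fun hk => ?_) (LocalBanach.mk q hq)
    (link_nuclear.clm_comp _) b_injective
  exact ⟨LocalBanach.isUltrametricDist hqa, strongDual_isUltrametricDist _⟩

end MapsToDual

section SupremaOfSeminorms

variable {k : Type uk} [NontriviallyNormedField k] {E : Type u} [AddCommGroup E] [Module k E]

theorem isAdmissible_sup {p q : Seminorm k E} (hp : p.IsAdmissible) (hq : q.IsAdmissible) :
    (p ⊔ q).IsAdmissible := fun hk x y => by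
  simp only [Seminorm.sup_apply]
  exact (max_le_max (hp hk x y) (hq hk x y)).trans_eq (max_max_max_comm _ _ _ _)

theorem isAdmissible_smul {p : Seminorm k E} (hp : p.IsAdmissible) (c : NNReal) :
    (c • p).IsAdmissible := fun hk x y =>
  (mul_le_mul_of_nonneg_left (hp hk x y) c.2).trans_eq (mul_max_of_nonneg _ _ c.2)

variable {ι : Type*} {p : ι → Seminorm k E}

theorem apply_le_iSup_seminorm (hp : BddAbove (Set.range p)) (i : ι) (x : E) :
    p i x ≤ (⨆ i, p i) x :=
  le_ciSup hp i x

theorem iSup_seminorm_apply_le (hp : BddAbove (Set.range p)) {x : E} {M : ℝ} (hM : 0 ≤ M)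
    (h : ∀ i, p i x ≤ M) : (⨆ i, p i) x ≤ M := by
  rw [Seminorm.iSup_apply hp]
  exact Real.iSup_le h hM

theorem isAdmissible_iSup (hp : BddAbove (Set.range p)) (hpa : ∀ i, (p i).IsAdmissible) :
    (⨆ i, p i).IsAdmissible := fun hk x y =>
  iSup_seminorm_apply_le hp (le_max_of_le_left (apply_nonneg _ x)) fun i =>
    (hpa i hk x y).trans <|
      max_le_max (apply_le_iSup_seminorm hp i x) (apply_le_iSup_seminorm hp i y)

end SupremaOfSeminorms

section DefiningSequences

variable {k : Type uk} [NontriviallyNormedField k] {V : Type u} [AddCommGroup V] [Module k V]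
  [TopologicalSpace V]

/-- An increasing sequence of continuous admissible seminorms whose unit balls form a
neighbourhood basis of `0`; it defines the topology of a metrizable locally convex space. -/
structure IsDefiningSequence (r : ℕ → Seminorm k V) : Prop where
  monotone : Monotone r
  continuous : ∀ n, Continuous (r n)
  isAdmissible : ∀ n, (r n).IsAdmissible
  exists_ball_subset : ∀ X ∈ 𝓝 (0 : V), ∃ n, {x | r n x < 1} ⊆ X

variable [FirstCountableTopology V]

theorem IsLocallyConvex.exists_isDefiningSequence_of_rel (hV : IsLocallyConvex k V)
    {R : Seminorm k V → Seminorm k V → Prop} (hR : ∀ p q q', R p q → q ≤ q' → R p q')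
    (hstep : ∀ p : Seminorm k V, Continuous p → p.IsAdmissible →
      ∃ q : Seminorm k V, p ≤ q ∧ Continuous q ∧ q.IsAdmissible ∧ R p q) :
    ∃ r : ℕ → Seminorm k V, IsDefiningSequence r ∧ ∀ n, R (r n) (r (n + 1)) := by
  obtain ⟨A, hA⟩ := (𝓝 (0 : V)).exists_antitone_basis
  choose s hs hsa hsA using fun n => hV (A n) (hA.1.mem_of_mem trivial)
  choose! next le_next next_cont next_adm next_rel using hstep
  let r : ℕ → Seminorm k V := fun n => Nat.rec (s 0) (fun n p => next p ⊔ s (n + 1)) n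
  have r_spec (n : ℕ) : Continuous (r n) ∧ (r n).IsAdmissible := by
    induction n with
    | zero => exact ⟨hs 0, hsa 0⟩
    | succ n ih => exact ⟨(next_cont _ ih.1 ih.2).sup (hs _),
        isAdmissible_sup (next_adm _ ih.1 ih.2) (hsa _)⟩
  have s_le (n : ℕ) : s n ≤ r n := by
    cases n with
    | zero => exact le_rfl
    | succ n => exact le_sup_right (a := next (r n))
  refine ⟨r, ⟨monotone_nat_of_le_succ fun n => ?_, fun n => (r_spec n).1, fun n => (r_spec n).2,
    fun X hX => ?_⟩, fun n => ?_⟩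
  · exact (le_next _ (r_spec n).1 (r_spec n).2).trans le_sup_left
  · obtain ⟨n, -, hn⟩ := hA.1.mem_iff.1 hX
    exact ⟨n, fun x hx => hn (hsA n ((s_le n x).trans_lt hx))⟩
  · exact hR _ _ _ (next_rel _ (r_spec n).1 (r_spec n).2) le_sup_left

theorem IsLocallyConvex.exists_isDefiningSequence (hV : IsLocallyConvex k V) :
    ∃ r : ℕ → Seminorm k V, IsDefiningSequence r := by
  obtain ⟨r, hr, -⟩ := hV.exists_isDefiningSequence_of_rel (R := fun _ _ => True)
    (fun _ _ _ _ _ => trivial) fun p hp hpa => ⟨p, le_rfl, hp, hpa, trivial⟩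
  exact ⟨r, hr⟩

end DefiningSequences

section CountableNeighborhoodProperty

/-- The countable neighbourhood property of a locally convex space: for any sequence of continuous
seminorms there is one continuous admissible seminorm which dominates all of them up to
constants. -/
def HasCountableNeighborhoodProperty (k : Type uk) [NontriviallyNormedField k] (W : Type v)
    [AddCommGroup W] [Module k W] [TopologicalSpace W] : Prop :=
  ∀ p : ℕ → Seminorm k W, (∀ n, Continuous (p n)) →
    ∃ s : Seminorm k W, Continuous s ∧ s.IsAdmissible ∧ ∀ n, ∃ C, ∀ x, p n x ≤ C * s x

namespace HasCountableNeighborhoodProperty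

variable {k : Type uk} [NontriviallyNormedField k] {W : Type v} [AddCommGroup W] [Module k W]
  [TopologicalSpace W]

theorem of_equiv {W' : Type w} [AddCommGroup W'] [Module k W'] [TopologicalSpace W']
    (e : W ≃L[k] W') (hW' : HasCountableNeighborhoodProperty k W') :
    HasCountableNeighborhoodProperty k W := by
  intro p hp
  obtain ⟨s, hs, hsa, hps⟩ := hW' (fun n => (p n).comp e.symm.toLinearMap)
    fun n => (hp n).comp e.symm.continuous
  refine ⟨s.comp e.toLinearMap, hs.comp e.continuous, fun hk x y => ?_, fun n => ?_⟩
  · simpa using hsa hk (e x) (e y)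
  · obtain ⟨C, hC⟩ := hps n
    exact ⟨C, fun x => by simpa using hC (e x)⟩

theorem exists_factorization [IsTopologicalAddGroup W] (hW : HasCountableNeighborhoodProperty k W)
    {V : Type u} [AddCommGroup V] [Module k V] [UniformSpace V] [IsUniformAddGroup V]
    [ContinuousConstSMul k V] [T0Space V] [CompleteSpace V] {r : ℕ → Seminorm k V}
    (hr : IsDefiningSequence r) (g : W →L[k] V) :
    ∃ (s : Seminorm k W) (hs : Continuous s) (G : LocalBanach s →L[k] V),
      s.IsAdmissible ∧ g = G.comp (LocalBanach.mk s hs) := by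
  obtain ⟨s, hs, hsa, hrs⟩ := hW (fun n => (r n).comp g.toLinearMap)
    fun n => (hr.continuous n).comp g.continuous
  let G : SeminormSpace s →L[k] V :=
    SeminormSpace.lift hr.exists_ball_subset s g.toLinearMap hrs
  refine ⟨s, hs, LocalBanach.extend G, hsa, ?_⟩
  ext x
  exact (LocalBanach.extend_of G x).symm

end HasCountableNeighborhoodProperty

variable {k : Type uk} [NontriviallyNormedField k] {U : Type w} [AddCommGroup U] [Module k U]
  [TopologicalSpace U]

theorem bddAbove_range_evalSeminorm {A : Set U} (hA : Bornology.IsVonNBounded k A) :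
    BddAbove (Set.range fun u : A => evalSeminorm k (u : U)) := by
  refine Seminorm.bddAbove_range_iff.2 fun φ => ?_
  obtain ⟨M, hM⟩ := ((NormedSpace.isVonNBounded_iff k).1 (hA.image φ)).exists_norm_le
  exact ⟨M, Set.forall_mem_range.2 fun u => hM _ (Set.mem_image_of_mem φ u.2)⟩

variable (k) in
/-- The seminorm `φ ↦ sup ‖φ u‖`, `u ∈ A`, of uniform convergence on `A`, which is junk if `A` is
unbounded. -/
noncomputable def uniformSeminorm (A : Set U) : Seminorm k (StrongDual k U) :=
  ⨆ u : A, evalSeminorm k (u : U)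

section Bounded

variable {A : Set U} (hA : Bornology.IsVonNBounded k A)
include hA

theorem norm_apply_le_uniformSeminorm {u : U} (hu : u ∈ A) (φ : StrongDual k U) :
    ‖φ u‖ ≤ uniformSeminorm k A φ :=
  apply_le_iSup_seminorm (bddAbove_range_evalSeminorm hA) ⟨u, hu⟩ φ

theorem uniformSeminorm_le {φ : StrongDual k U} {M : ℝ} (hM : 0 ≤ M) (h : ∀ u ∈ A, ‖φ u‖ ≤ M) :
    uniformSeminorm k A φ ≤ M :=
  iSup_seminorm_apply_le (bddAbove_range_evalSeminorm hA) hM fun u => h u u.2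

theorem isAdmissible_uniformSeminorm : (uniformSeminorm k A).IsAdmissible :=
  isAdmissible_iSup (bddAbove_range_evalSeminorm hA) fun u _ φ ψ =>
    IsUltrametricDist.norm_add_le_max (φ u) (ψ u)

theorem continuous_uniformSeminorm : Continuous (uniformSeminorm k A) := by
  refine Seminorm.continuous' (r := 1) (mem_of_superset
    (ContinuousLinearMap.hasBasis_nhds_zero.mem_of_mem (i := (A, Metric.ball (0 : k) 1))
      ⟨hA, Metric.ball_mem_nhds _ one_pos⟩) fun φ hφ => ?_)
  rw [Seminorm.mem_closedBall_zero]
  exact uniformSeminorm_le hA zero_le_one fun u hu => (mem_ball_zero_iff.1 (hφ u hu)).le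

end Bounded

theorem exists_le_mul_uniformSeminorm {p : Seminorm k (StrongDual k U)} (hp : Continuous p) :
    ∃ (D : Set U) (C : ℝ), Bornology.IsVonNBounded k D ∧ ∀ φ, p φ ≤ C * uniformSeminorm k D φ := by
  obtain ⟨c, hc⟩ := NormedField.exists_one_lt_norm k
  have ball_mem : {φ | p φ < 1} ∈ 𝓝 (0 : StrongDual k U) :=
    (isOpen_lt hp continuous_const).mem_nhds (by simp)
  obtain ⟨⟨D, ε⟩, ⟨hD, hε⟩, hDε⟩ := (ContinuousLinearMap.hasBasis_nhds_zero_of_basis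
    (Metric.nhds_basis_ball (x := (0 : k)))).mem_iff.1 ball_mem
  obtain ⟨t, ht_pos, ht⟩ := NormedField.exists_norm_lt k hε
  refine ⟨D, ‖c‖ * ‖t‖⁻¹, hD,
    seminorm_le_mul_of_forall_lt_one p (uniformSeminorm k D) hc fun φ hφ => ?_⟩
  have p_smul_lt : p (t • φ) < 1 := hDε fun u hu => by
    rw [mem_ball_zero_iff]
    calc ‖t * φ u‖ = ‖t‖ * ‖φ u‖ := norm_mul t (φ u)
      _ ≤ ‖t‖ * 1 := by
        gcongr
        exact (norm_apply_le_uniformSeminorm hD hu φ).trans hφ.le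
      _ < ε := by rwa [mul_one]
  rw [map_smul_eq_mul, ← lt_div_iff₀' ht_pos, one_div] at p_smul_lt
  exact p_smul_lt.le

variable [ContinuousSMul k U] [FirstCountableTopology U]

-- Mackey's countability condition: scale `D n` into the `n`-th neighbourhood of a basis.
theorem exists_isVonNBounded_iUnion_smul {D : ℕ → Set U}
    (hD : ∀ n, Bornology.IsVonNBounded k (D n)) :
    ∃ c : ℕ → k, (∀ n, c n ≠ 0) ∧ Bornology.IsVonNBounded k (⋃ n, (c n • ·) '' D n) := by
  obtain ⟨B, hB⟩ := (𝓝 (0 : U)).exists_antitone_basis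
  have exists_smul_subset (n : ℕ) : ∃ c : k, c ≠ 0 ∧ ∀ u ∈ D n, c • u ∈ B n := by
    obtain ⟨a, ha, ha0⟩ :=
      ((hD n (hB.1.mem_of_mem trivial)).and (Bornology.eventually_ne_cobounded 0)).exists
    exact ⟨a⁻¹, inv_ne_zero ha0, fun u hu => (Set.mem_smul_set_iff_inv_smul_mem₀ ha0 _ _).1 (ha hu)⟩
  choose c hc hcB using exists_smul_subset
  refine ⟨c, hc, fun X hX => ?_⟩
  obtain ⟨Y, ⟨hY, Y_balanced⟩, hYX⟩ := (nhds_basis_balanced k U).mem_iff.1 hX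
  obtain ⟨n, -, hn⟩ := hB.1.mem_iff.1 hY
  have finite_part : Absorbs k X (⋃ m ∈ Set.Iio n, (c m • ·) '' D m) :=
    (Set.finite_Iio n).absorbs_biUnion.2 fun m _ => (hD m).image (c m • .id k U) hX
  have tail : Absorbs k X Y := Y_balanced.absorbs_self.mono_left hYX
  refine (finite_part.union tail).mono_right (Set.iUnion_subset fun m => ?_)
  rcases lt_or_ge m n with hmn | hnm
  · exact Set.subset_union_of_subset_left
      (Set.subset_biUnion_of_mem (u := fun m => (c m • ·) '' D m) (Set.mem_Iio.2 hmn)) _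
  · rintro _ ⟨u, hu, rfl⟩
    exact Or.inr (hn (hB.2 hnm (hcB m u hu)))

theorem strongDual_hasCountableNeighborhoodProperty :
    HasCountableNeighborhoodProperty k (StrongDual k U) := by
  intro p hp
  choose D C hD hpD using fun n => exists_le_mul_uniformSeminorm (hp n)
  obtain ⟨c, hc, hA⟩ := exists_isVonNBounded_iUnion_smul hD
  refine ⟨uniformSeminorm k _, continuous_uniformSeminorm hA, isAdmissible_uniformSeminorm hA,
    fun n => ⟨|C n| * ‖c n‖⁻¹, fun φ => ?_⟩⟩
  have hφ : uniformSeminorm k (D n) φ ≤ ‖c n‖⁻¹ * uniformSeminorm k (⋃ n, (c n • ·) '' D n) φ := by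
    refine uniformSeminorm_le (hD n) (by positivity) fun u hu => ?_
    have := norm_apply_le_uniformSeminorm hA
      (Set.mem_iUnion.2 ⟨n, Set.mem_image_of_mem _ hu⟩) φ
    rwa [map_smul, norm_smul, ← le_inv_mul_iff₀ (norm_pos_iff.2 (hc n))] at this
  calc p n φ ≤ |C n| * uniformSeminorm k (D n) φ :=
        (hpD n φ).trans (mul_le_mul_of_nonneg_right (le_abs_self _) (apply_nonneg _ _))
    _ ≤ |C n| * ‖c n‖⁻¹ * uniformSeminorm k (⋃ n, (c n • ·) '' D n) φ := by
      rw [mul_assoc]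
      gcongr

end CountableNeighborhoodProperty

section BanachDiscs

variable {k : Type uk} [NontriviallyNormedField k] {V : Type u} [AddCommGroup V] [Module k V]
  {ι : Type*} (P : ι → Seminorm k V)

/-- The subspace of the vectors on which a family of seminorms is bounded. -/
def boundedVectors : Submodule k V where
  carrier := {v | BddAbove (Set.range fun i => P i v)}
  zero_mem' := ⟨0, by simp [upperBounds]⟩
  add_mem' := by
    rintro x y ⟨a, ha⟩ ⟨b, hb⟩
    exact ⟨a + b, Set.forall_mem_range.2 fun i => (map_add_le_add (P i) x y).trans <|
      add_le_add (Set.forall_mem_range.1 ha i) (Set.forall_mem_range.1 hb i)⟩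
  smul_mem' := by
    rintro c x ⟨a, ha⟩
    refine ⟨‖c‖ * a, Set.forall_mem_range.2 fun i => ?_⟩
    rw [map_smul_eq_mul]
    exact mul_le_mul_of_nonneg_left (Set.forall_mem_range.1 ha i) (norm_nonneg c)

/-- The supremum of a family of seminorms, on the subspace where it is finite. Its completion plays
the role of the Banach space spanned by the disc `{v | ∀ i, P i v ≤ 1}`. -/
noncomputable def supSeminorm : Seminorm k (boundedVectors P) :=
  ⨆ i, (P i).comp (boundedVectors P).subtype

variable {P}

theorem mem_boundedVectors {v : V} {M : ℝ} (h : ∀ i, P i v ≤ M) : v ∈ boundedVectors P :=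
  ⟨M, Set.forall_mem_range.2 h⟩

theorem bddAbove_range_comp_subtype :
    BddAbove (Set.range fun i => (P i).comp (boundedVectors P).subtype) :=
  Seminorm.bddAbove_range_iff.2 fun v => v.2

theorem apply_le_supSeminorm (i : ι) (v : boundedVectors P) : P i v ≤ supSeminorm P v :=
  apply_le_iSup_seminorm bddAbove_range_comp_subtype i v

theorem supSeminorm_le {v : boundedVectors P} {M : ℝ} (hM : 0 ≤ M) (h : ∀ i, P i v ≤ M) :
    supSeminorm P v ≤ M :=
  iSup_seminorm_apply_le bddAbove_range_comp_subtype hM h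

theorem isAdmissible_supSeminorm (hP : ∀ i, (P i).IsAdmissible) : (supSeminorm P).IsAdmissible :=
  isAdmissible_iSup bddAbove_range_comp_subtype fun i hk x y => hP i hk x y

theorem exists_lift_localBanach_supSeminorm {E : Type v} [SeminormedAddCommGroup E]
    [NormedSpace k E] {G : E →ₗ[k] V} {A : ℝ} (hG : ∀ i x, P i (G x) ≤ A * ‖x‖) :
    ∃ T : E →L[k] LocalBanach (supSeminorm P), ∀ x, ∃ hx : G x ∈ boundedVectors P,
      T x = LocalBanach.of (supSeminorm P) ⟨G x, hx⟩ := by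
  have G_mem (x : E) : G x ∈ boundedVectors P := mem_boundedVectors fun i => hG i x
  refine ⟨(LocalBanach.of (supSeminorm P) ∘ₗ G.codRestrict _ G_mem).mkContinuous |A| fun x => ?_,
    fun x => ⟨G_mem x, rfl⟩⟩
  calc ‖LocalBanach.of (supSeminorm P) ⟨G x, G_mem x⟩‖ = supSeminorm P ⟨G x, G_mem x⟩ :=
        LocalBanach.norm_of _ _
    _ ≤ |A| * ‖x‖ := supSeminorm_le (by positivity) fun i => (hG i x).trans <|
        mul_le_mul_of_nonneg_right (le_abs_self A) (norm_nonneg x)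

variable [UniformSpace V] [IsUniformAddGroup V] [ContinuousConstSMul k V] [T0Space V]
  [CompleteSpace V] {r : ℕ → Seminorm k V} {c : ℕ → NNReal}

/-- The canonical map to `V` from the Banach space attached to the supremum of the seminorms
`c m • r m`. -/
noncomputable def IsDefiningSequence.discMap (hr : IsDefiningSequence r) (hc : ∀ m, 0 < c m) :
    LocalBanach (supSeminorm fun m => c m • r m) →L[k] V :=
  LocalBanach.extend <| SeminormSpace.lift hr.exists_ball_subset _ (boundedVectors _).subtype
    fun m => ⟨(c m : ℝ)⁻¹, fun v => by
      rw [le_inv_mul_iff₀ (NNReal.coe_pos.2 (hc m))]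
      exact apply_le_supSeminorm (P := fun m => c m • r m) m v⟩

theorem IsDefiningSequence.discMap_of (hr : IsDefiningSequence r) (hc : ∀ m, 0 < c m)
    (v : boundedVectors fun m => c m • r m) : hr.discMap hc (LocalBanach.of _ v) = v :=
  LocalBanach.extend_of _ v

end BanachDiscs

theorem exists_weights_summable_mul {a : ℕ → ℝ} (ha : ∀ n, 0 ≤ a n) :
    ∃ c : ℕ → NNReal, c 0 = 1 ∧ (∀ n, 0 < c n) ∧ (∀ n, c n ≤ 1) ∧
      Summable fun n => (c n : ℝ) * a n := by
  let c : ℕ → NNReal := fun n => if n = 0 then 1 else (1 / 2) ^ n / (1 + (a n).toNNReal)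
  have c_succ (n : ℕ) : c (n + 1) = (1 / 2) ^ (n + 1) / (1 + (a (n + 1)).toNNReal) :=
    if_neg n.succ_ne_zero
  refine ⟨c, if_pos rfl, fun n => ?_, fun n => ?_, (summable_nat_add_iff 1).1 <|
    .of_nonneg_of_le (fun n => mul_nonneg (c (n + 1)).2 (ha _)) (fun n => ?_)
      ((summable_nat_add_iff 1).2 summable_geometric_two)⟩
  · cases n with
    | zero => exact one_pos
    | succ n => rw [c_succ]; positivity
  · cases n with
    | zero => exact le_rfl
    | succ n =>
      rw [c_succ]
      exact div_le_one_of_le₀ ((pow_le_one₀ zero_le (by norm_num)).trans le_self_add) zero_le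
  · rw [c_succ]
    push_cast
    have := ha (n + 1)
    rw [Real.coe_toNNReal _ this, div_mul_eq_mul_div, div_le_iff₀ (by positivity)]
    gcongr
    linarith

section CompactMaps

variable {k : Type uk} [NontriviallyNormedField k] {E : Type v} [SeminormedAddCommGroup E]
  [NormedSpace k E]

theorem exists_mul_norm_le_of_continuous_seminorm {V : Type u} [AddCommGroup V] [Module k V]
    [TopologicalSpace V] [IsTopologicalAddGroup V] (G : E →L[k] V) {p : Seminorm k V}
    (hp : Continuous p) : ∃ C, 0 ≤ C ∧ ∀ x, p (G x) ≤ C * ‖x‖ :=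
  ⟨‖(LocalBanach.mk p hp).comp G‖, norm_nonneg _, fun x =>
    (LocalBanach.norm_of p (G x)).symm.trans_le (((LocalBanach.mk p hp).comp G).le_opNorm x)⟩

theorem isCompactOperator_iff_exists_finite_net {F : Type w} [NormedAddCommGroup F]
    [NormedSpace k F] [CompleteSpace F] {T : E →L[k] F} :
    IsCompactOperator T ↔ ∀ ε > 0, ∃ t ⊆ Metric.closedBall (0 : E) 1, t.Finite ∧
      ∀ x ∈ Metric.closedBall 0 1, ∃ z ∈ t, ‖T (x - z)‖ < ε := by
  constructor
  · intro hT ε hε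
    obtain ⟨K, hK, hKT⟩ := hT.image_closedBall_subset_compact (f := T.toLinearMap) 1
    obtain ⟨t, ht, ht_fin, ht_cover⟩ := Set.exists_subset_image_finite_and.1 <|
      Metric.finite_approx_of_totallyBounded (hK.totallyBounded.subset hKT) ε hε
    refine ⟨t, ht, ht_fin, fun x hx => ?_⟩
    obtain ⟨_, ⟨z, hz, rfl⟩, hxz⟩ := Set.mem_iUnion₂.1 (ht_cover (Set.mem_image_of_mem _ hx))
    exact ⟨z, hz, by rwa [map_sub, ← dist_eq_norm]⟩
  · intro hT
    have image_totallyBounded : TotallyBounded (T '' Metric.closedBall 0 1) := by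
      refine Metric.totallyBounded_iff.2 fun ε hε => ?_
      obtain ⟨t, -, ht_fin, ht⟩ := hT ε hε
      refine ⟨T '' t, ht_fin.image T, Set.image_subset_iff.2 fun x hx => ?_⟩
      obtain ⟨z, hz, hxz⟩ := ht x hx
      refine Set.mem_biUnion (Set.mem_image_of_mem T hz) ?_
      rwa [Metric.mem_ball, dist_eq_norm, ← map_sub]
    exact (isCompactOperator_iff_exists_mem_nhds_image_subset_compact _).2
      ⟨_, Metric.closedBall_mem_nhds _ one_pos, _,
        image_totallyBounded.closure.isCompact_of_isClosed isClosed_closure, subset_closure⟩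

theorem IsNuclearSpace.exists_finite_net [IsUltrametricDist k] {V : Type u} [AddCommGroup V]
    [Module k V] [TopologicalSpace V] [IsTopologicalAddGroup V]
    (hV : IsNuclearSpace k V) (G : E →L[k] V) {p : Seminorm k V} (hp : Continuous p)
    (hpa : p.IsAdmissible) {ε : ℝ} (hε : 0 < ε) :
    ∃ t ⊆ Metric.closedBall (0 : E) 1, t.Finite ∧
      ∀ x ∈ Metric.closedBall 0 1, ∃ z ∈ t, p (G (x - z)) < ε := by
  obtain ⟨q, hpq, hq, -, link_compact, -⟩ := hV p hp hpa
  have hT : IsCompactOperator ((LocalBanach.link hpq).comp ((LocalBanach.mk q hq).comp G)) :=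
    (link_compact ‹_›).comp_clm _
  simpa only [ContinuousLinearMap.comp_apply, LocalBanach.mk_apply, LocalBanach.link_of,
    LocalBanach.norm_of] using isCompactOperator_iff_exists_finite_net.1 hT ε hε

theorem IsDefiningSequence.exists_finite_net [IsUltrametricDist k] {V : Type u} [AddCommGroup V]
    [Module k V] [TopologicalSpace V] [IsTopologicalAddGroup V] {r : ℕ → Seminorm k V}
    (hr : IsDefiningSequence r) (hV : IsNuclearSpace k V) {G : E →L[k] V} {C : ℕ → ℝ}
    (hC : ∀ m x, r m (G x) ≤ C m * ‖x‖) {c : ℕ → NNReal} (hc : ∀ m, c m ≤ 1)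
    (hcC : Tendsto (fun m => c m * C m) atTop (𝓝 0)) {ε : ℝ} (hε : 0 < ε) :
    ∃ t ⊆ Metric.closedBall (0 : E) 1, t.Finite ∧
      ∀ x ∈ Metric.closedBall 0 1, ∃ z ∈ t, ∀ m, c m * r m (G (x - z)) ≤ ε := by
  obtain ⟨M, hM⟩ :=
    eventually_atTop.1 (hcC.eventually_lt_const (show 0 < ε / 2 by positivity))
  obtain ⟨t, ht, ht_fin, ht_net⟩ := hV.exists_finite_net G (hr.continuous M) (hr.isAdmissible M) hε
  refine ⟨t, ht, ht_fin, fun x hx => ?_⟩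
  obtain ⟨z, hz, hxz⟩ := ht_net x hx
  refine ⟨z, hz, fun m => ?_⟩
  obtain hm | hm := le_total m M
  · calc c m * r m (G (x - z)) ≤ 1 * r M (G (x - z)) :=
          mul_le_mul (hc m) (hr.monotone hm _) (apply_nonneg _ _) zero_le_one
      _ ≤ ε := (one_mul _).trans_le hxz.le
  · have norm_sub_le_two : ‖x - z‖ ≤ 1 + 1 := (norm_sub_le x z).trans <|
      add_le_add (mem_closedBall_zero_iff.1 hx) (mem_closedBall_zero_iff.1 (ht hz))
    calc c m * r m (G (x - z)) ≤ c m * (C m * ‖x - z‖) :=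
          mul_le_mul_of_nonneg_left (hC m _) (c m).2
      _ = c m * C m * ‖x - z‖ := (mul_assoc ..).symm
      _ ≤ ε / 2 * (1 + 1) := mul_le_mul (hM m hm).le norm_sub_le_two (norm_nonneg _) (by positivity)
      _ = ε := by ring

theorem IsDefiningSequence.exists_isCompactOperator_discMap_comp [IsUltrametricDist k]
    {V : Type u} [AddCommGroup V] [Module k V] [UniformSpace V] [IsUniformAddGroup V]
    [ContinuousConstSMul k V] [T0Space V] [CompleteSpace V] {r : ℕ → Seminorm k V}
    (hr : IsDefiningSequence r) (hV : IsNuclearSpace k V) (G : E →L[k] V) :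
    ∃ (c : ℕ → NNReal) (hc : ∀ m, 0 < c m)
      (T : E →L[k] LocalBanach (supSeminorm fun m => c m • r m)),
      IsCompactOperator T ∧ G = (hr.discMap hc).comp T := by
  choose C hC0 hC using fun m => exists_mul_norm_le_of_continuous_seminorm G (hr.continuous m)
  obtain ⟨c, -, hc, hc1, hcC⟩ := exists_weights_summable_mul hC0
  have le_tsum_mul_norm (m : ℕ) (x : E) : c m * r m (G x) ≤ (∑' m, c m * C m) * ‖x‖ :=
    calc c m * r m (G x) ≤ c m * (C m * ‖x‖) := mul_le_mul_of_nonneg_left (hC m x) (c m).2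
      _ = c m * C m * ‖x‖ := (mul_assoc ..).symm
      _ ≤ (∑' m, c m * C m) * ‖x‖ := mul_le_mul_of_nonneg_right
          (hcC.le_tsum m fun m _ => mul_nonneg (c m).2 (hC0 m)) (norm_nonneg x)
  obtain ⟨T, hT⟩ := exists_lift_localBanach_supSeminorm (P := fun m => c m • r m)
    (G := G.toLinearMap) le_tsum_mul_norm
  refine ⟨c, hc, T, isCompactOperator_iff_exists_finite_net.2 fun ε hε => ?_, ?_⟩
  · obtain ⟨t, ht, ht_fin, ht_net⟩ :=
      hr.exists_finite_net hV hC hc1 hcC.tendsto_atTop_zero (half_pos hε)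
    refine ⟨t, ht, ht_fin, fun x hx => ?_⟩
    obtain ⟨z, hz, hxz⟩ := ht_net x hx
    obtain ⟨_, hTxz⟩ := hT (x - z)
    refine ⟨z, hz, ?_⟩
    rw [hTxz, LocalBanach.norm_of]
    exact (supSeminorm_le (half_pos hε).le hxz).trans_lt (half_lt_self hε)
  · ext x
    obtain ⟨_, hTx⟩ := hT x
    rw [ContinuousLinearMap.comp_apply, hTx, hr.discMap_of]
    rfl

end CompactMaps

theorem IsFN.isNuclearMap_of_isUltrametricDist {k : Type uk} [NontriviallyNormedField k]
    [ProperSpace k] [IsUltrametricDist k] {V : Type u} [AddCommGroup V] [Module k V]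
    [UniformSpace V] (hV : IsFN k V) {E : Type v} [NormedAddCommGroup E] [NormedSpace k E]
    [CompleteSpace E] [IsUltrametricDist E] (G : E →L[k] V) : IsNuclearMap G := by
  obtain ⟨⟨_, _, hVc, _, _, _⟩, hVn⟩ := hV
  obtain ⟨r, hr⟩ := hVc.exists_isDefiningSequence
  obtain ⟨c, hc, T, hT, rfl⟩ := hr.exists_isCompactOperator_discMap_comp hVn G
  have := LocalBanach.isUltrametricDist (isAdmissible_supSeminorm fun m =>
    isAdmissible_smul (hr.isAdmissible m) (c m))
  exact ⟨E, _, _, _, _, _, .id k E, T, hr.discMap hc, ‹_›, inferInstance,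
    fun _ => ⟨‹_›, this⟩, isNuclearOperator_of_isCompactOperator hT, rfl⟩

section NuclearSeries

variable {k : Type uk} [NontriviallyNormedField k]

theorem exists_isNuclearOperator_hasSum (hk : ¬ IsUltrametricDist k) {E : Type v}
    [NormedAddCommGroup E] [NormedSpace k E] {F : Type w} [NormedAddCommGroup F] [NormedSpace k F]
    [CompleteSpace F] {I : Type*} [Countable I] {φ : I → StrongDual k E} {y : I → F}
    (hφy : Summable fun i => ‖φ i‖ * ‖y i‖) :
    ∃ T : E →L[k] F, IsNuclearOperator T ∧ ∀ x, HasSum (fun i => φ i x • y i) (T x) := by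
  have summable_smulRight : Summable fun i => (φ i).smulRight (y i) :=
    .of_norm (by simpa only [ContinuousLinearMap.norm_smulRight_apply] using hφy)
  have hasSum_apply (x : E) : HasSum (fun i => φ i x • y i) ((∑' i, (φ i).smulRight (y i)) x) :=
    summable_smulRight.hasSum.mapL (ContinuousLinearMap.apply k F x)
  obtain ⟨e, he⟩ := exists_injective_nat I
  have extend_eq_zero (n : ℕ) (hn : n ∉ Set.range e) : Function.extend e φ 0 n = 0 :=
    Function.extend_apply' _ _ _ hn
  refine ⟨∑' i, (φ i).smulRight (y i), ⟨Function.extend e φ 0, Function.extend e y 0,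
    fun h => (hk h).elim, fun _ => ?_, fun x => ?_⟩, hasSum_apply⟩
  · refine (he.summable_iff fun n hn => ?_).1 ?_
    · rw [extend_eq_zero n hn, norm_zero, zero_mul]
    · simpa only [Function.comp_def, he.extend_apply] using hφy
  · refine (he.hasSum_iff fun n hn => ?_).1 ?_
    · rw [extend_eq_zero n hn, zero_apply, zero_smul]
    · simpa only [Function.comp_def, he.extend_apply] using hasSum_apply x

theorem exists_weights_mul_le_summable {I : Type*} {a : ℕ → I → ℝ} (ha : ∀ m i, 0 ≤ a m i)
    (hs : ∀ m, Summable (a m)) :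
    ∃ (c : ℕ → NNReal) (b : I → ℝ), (∀ m, 0 < c m) ∧ Summable b ∧ ∀ m i, c m * a m i ≤ b i := by
  obtain ⟨c, -, hc, -, hca⟩ := exists_weights_summable_mul fun m => tsum_nonneg (ha m)
  have nonneg : 0 ≤ fun x : ℕ × I => (c x.1 : ℝ) * a x.1 x.2 := fun x =>
    mul_nonneg (c x.1).2 (ha _ _)
  have summable_prod : Summable fun x : ℕ × I => (c x.1 : ℝ) * a x.1 x.2 :=
    (summable_prod_of_nonneg nonneg).2
      ⟨fun m => (hs m).mul_left (c m : ℝ), by simpa only [tsum_mul_left] using hca⟩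
  exact ⟨c, fun i => ∑' m, c m * a m i, hc, summable_prod.prod_symm.prod, fun m i =>
    (summable_prod.prod_symm.prod_factor i).le_tsum m fun m _ => nonneg (m, i)⟩

variable {V : Type u} [AddCommGroup V] [Module k V] [UniformSpace V] [IsUniformAddGroup V]
  [ContinuousConstSMul k V] [T0Space V] [CompleteSpace V] {r : ℕ → Seminorm k V}
  {E : Type v} [NormedAddCommGroup E] [NormedSpace k E] [CompleteSpace E]

theorem IsDefiningSequence.exists_isNuclearMap_hasSum (hr : IsDefiningSequence r)
    (hk : ¬ IsUltrametricDist k) {I : Type*} [Countable I] {φ : I → StrongDual k E} {v : I → V}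
    (hs : ∀ m, Summable fun i => ‖φ i‖ * r m (v i)) :
    ∃ H : E →L[k] V, IsNuclearMap H ∧ ∀ x, HasSum (fun i => φ i x • v i) (H x) := by
  obtain ⟨c, b, hc, hb, hcb⟩ := exists_weights_mul_le_summable
    (fun m i => mul_nonneg (norm_nonneg (φ i)) (apply_nonneg (r m) (v i))) hs
  have b_nonneg (i : I) : 0 ≤ b i :=
    (mul_nonneg (c 0).2 (mul_nonneg (norm_nonneg _) (apply_nonneg _ _))).trans (hcb 0 i)
  have exists_preimage (i : I) : ∃ y : LocalBanach (supSeminorm fun m => c m • r m),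
      (∀ x, φ i x • hr.discMap hc y = φ i x • v i) ∧ ‖φ i‖ * ‖y‖ ≤ b i := by
    obtain hφ | hφ := eq_or_ne (φ i) 0
    · exact ⟨0, by simp [hφ], by simpa using b_nonneg i⟩
    · have φ_pos : 0 < ‖φ i‖ := norm_pos_iff.2 hφ
      have le_div (m : ℕ) : (c m • r m) (v i) ≤ b i / ‖φ i‖ := by
        rw [le_div_iff₀' φ_pos]
        exact (mul_left_comm ..).trans_le (hcb m i)
      refine ⟨LocalBanach.of _ ⟨v i, mem_boundedVectors le_div⟩, fun x => by rw [hr.discMap_of],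
        ?_⟩
      rw [LocalBanach.norm_of, ← le_div_iff₀' φ_pos]
      exact supSeminorm_le (div_nonneg (b_nonneg i) φ_pos.le) le_div
  choose y hy hyb using exists_preimage
  obtain ⟨T, hT, hTx⟩ := exists_isNuclearOperator_hasSum hk <|
    Summable.of_nonneg_of_le (fun i => mul_nonneg (norm_nonneg _) (norm_nonneg _)) hyb hb
  refine ⟨(hr.discMap hc).comp T, ⟨E, _, _, _, _, _, .id k E, T, hr.discMap hc, ‹_›, inferInstance,
    fun h => (hk h).elim, hT, rfl⟩, fun x => ?_⟩
  simpa only [ContinuousLinearMap.comp_apply, map_smul, hy] using (hTx x).mapL (hr.discMap hc)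

end NuclearSeries

section FiniteNuclearNorms

variable {k : Type uk} [NontriviallyNormedField k]

/-- The operator `T` has finite rank, and nuclear norm at most `N` when its source carries the
seminorm `q` and its target the seminorm `p`. -/
def FiniteNuclearNormLE {X : Type v} {V : Type u} [AddCommGroup X] [Module k X]
    [TopologicalSpace X] [AddCommGroup V] [Module k V] [TopologicalSpace V] (T : X →L[k] V)
    (q : Seminorm k X) (p : Seminorm k V) (N : ℝ) : Prop :=
  ∃ (ι : Type) (_ : Fintype ι) (φ : ι → X →L[k] k) (a : ι → ℝ) (v : ι → V),
    (∀ i, 0 ≤ a i) ∧ (∀ i x, ‖φ i x‖ ≤ a i * q x) ∧ ∑ i, a i * p (v i) ≤ N ∧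
      ∀ x, T x = ∑ i, φ i x • v i

variable {X Y V : Type*} [AddCommGroup X] [Module k X] [TopologicalSpace X]
  [AddCommGroup Y] [Module k Y] [TopologicalSpace Y]
  [AddCommGroup V] [Module k V] [TopologicalSpace V]
  {q : Seminorm k X} {p : Seminorm k V} {M N : ℝ} {S T : X →L[k] V}

theorem FiniteNuclearNormLE.zero (hN : 0 ≤ N) :
    FiniteNuclearNormLE (0 : X →L[k] V) q p N :=
  ⟨Empty, inferInstance, nofun, nofun, nofun, nofun, nofun, by simpa using hN, by simp⟩

theorem FiniteNuclearNormLE.mono (hT : FiniteNuclearNormLE T q p M) (hMN : M ≤ N) :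
    FiniteNuclearNormLE T q p N := by
  obtain ⟨ι, _, φ, a, v, ha, hφ, hM, hT⟩ := hT
  exact ⟨ι, _, φ, a, v, ha, hφ, hM.trans hMN, hT⟩

theorem FiniteNuclearNormLE.sub [IsTopologicalAddGroup V] (hS : FiniteNuclearNormLE S q p M)
    (hT : FiniteNuclearNormLE T q p N) : FiniteNuclearNormLE (S - T) q p (M + N) := by
  obtain ⟨ι, _, φ, a, v, ha, hφ, hM, hS⟩ := hS
  obtain ⟨κ, _, ψ, b, w, hb, hψ, hN, hT⟩ := hT
  refine ⟨ι ⊕ κ, inferInstance, Sum.elim φ ψ, Sum.elim a b, Sum.elim v (-w), Sum.rec ha hb,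
    Sum.rec hφ hψ, ?_, fun x => ?_⟩
  · simpa only [Fintype.sum_sum_type, Sum.elim_inl, Sum.elim_inr, Pi.neg_apply, map_neg_eq_map]
      using add_le_add hM hN
  · simp only [sub_apply, hS, hT, Fintype.sum_sum_type, Sum.elim_inl, Sum.elim_inr,
      Pi.neg_apply, smul_neg, Finset.sum_neg_distrib, ← sub_eq_add_neg]

theorem FiniteNuclearNormLE.comp_right (hT : FiniteNuclearNormLE T q p N) {q' : Seminorm k Y}
    {R : Y →L[k] X} {C : ℝ} (hC : 0 ≤ C) (hR : ∀ y, q (R y) ≤ C * q' y) :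
    FiniteNuclearNormLE (T.comp R) q' p (N * C) := by
  obtain ⟨ι, _, φ, a, v, ha, hφ, hN, hT⟩ := hT
  refine ⟨ι, _, fun i => (φ i).comp R, fun i => a i * C, v, fun i => mul_nonneg (ha i) hC,
    fun i y => ?_, ?_, fun y => hT (R y)⟩
  · rw [mul_assoc]
    exact (hφ i (R y)).trans (mul_le_mul_of_nonneg_left (hR y) (ha i))
  · simp only [mul_right_comm _ C, ← Finset.sum_mul]
    exact mul_le_mul_of_nonneg_right hN hC

theorem FiniteNuclearNormLE.comp_left (hT : FiniteNuclearNormLE T q p N) {p' : Seminorm k Y}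
    {R : V →L[k] Y} {C : ℝ} (hC : 0 ≤ C) (hR : ∀ v, p' (R v) ≤ C * p v) :
    FiniteNuclearNormLE (R.comp T) q p' (C * N) := by
  obtain ⟨ι, _, φ, a, v, ha, hφ, hN, hT⟩ := hT
  refine ⟨ι, inferInstance, φ, a, R ∘ v, ha, hφ, ?_, fun x => ?_⟩
  · calc ∑ i, a i * p' (R (v i)) ≤ ∑ i, C * (a i * p (v i)) := Finset.sum_le_sum fun i _ =>
          (mul_le_mul_of_nonneg_left (hR (v i)) (ha i)).trans_eq (mul_left_comm ..)
      _ = C * ∑ i, a i * p (v i) := (Finset.mul_sum ..).symm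
      _ ≤ C * N := mul_le_mul_of_nonneg_left hN hC
  · rw [ContinuousLinearMap.comp_apply, hT, map_sum]
    simp only [map_smul, Function.comp_apply]

end FiniteNuclearNorms

theorem IsDefiningSequence.exists_isNuclearMap_hasSum_of_finiteNuclearNormLE {k : Type uk}
    [NontriviallyNormedField k] (hk : ¬ IsUltrametricDist k) {V : Type u} [AddCommGroup V]
    [Module k V] [UniformSpace V] [IsUniformAddGroup V] [ContinuousConstSMul k V] [T0Space V]
    [CompleteSpace V] {r : ℕ → Seminorm k V} (hr : IsDefiningSequence r) {E : Type v}
    [NormedAddCommGroup E] [NormedSpace k E] [CompleteSpace E] {D : ℕ → E →L[k] V} {ε : ℕ → ℝ}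
    (hD : ∀ n, FiniteNuclearNormLE (D n) (normSeminorm k E) (r n) (ε n)) (hε : Summable ε) :
    ∃ H : E →L[k] V, IsNuclearMap H ∧ ∀ x, HasSum (fun n => D n x) (H x) := by
  choose ι _ φ a v ha hφ hN hDx using hD
  have norm_le (n : ℕ) (i : ι n) : ‖φ n i‖ ≤ a n i :=
    (φ n i).opNorm_le_bound (ha n i) (hφ n i)
  have sum_le (m n : ℕ) (hmn : m ≤ n) : ∑ i, ‖φ n i‖ * r m (v n i) ≤ ε n :=
    (Finset.sum_le_sum fun i _ => mul_le_mul (norm_le n i) (hr.monotone hmn _)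
      (apply_nonneg _ _) (ha n i)).trans (hN n)
  have nonneg (m n : ℕ) (i : ι n) : 0 ≤ ‖φ n i‖ * r m (v n i) :=
    mul_nonneg (norm_nonneg _) (apply_nonneg _ _)
  have summable_mul (m : ℕ) :
      Summable fun i : Σ n, ι n => ‖φ i.1 i.2‖ * r m (v i.1 i.2) := by
    refine (summable_sigma_of_nonneg fun i => nonneg m i.1 i.2).2
      ⟨fun n => (hasSum_fintype _).summable, ?_⟩
    simp only [tsum_fintype]
    refine hε.of_norm_bounded_eventually_nat (eventually_atTop.2 ⟨m, fun n hn => ?_⟩)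
    rw [Real.norm_of_nonneg (Finset.sum_nonneg fun i _ => nonneg m n i)]
    exact sum_le m n hn
  obtain ⟨H, hH, hHx⟩ := hr.exists_isNuclearMap_hasSum hk summable_mul
  refine ⟨H, hH, fun x => ?_⟩
  simpa only [hDx] using (hHx x).sigma fun n => hasSum_fintype _

section NuclearDomination

theorem exists_eventually_zero_tsum_le_of_denseRange {X F : Type*} [Zero X]
    [SeminormedAddCommGroup F] {f : X → F} (hf : DenseRange f) (hf0 : f 0 = 0) {a : ℕ → ℝ}
    (ha : ∀ n, 0 ≤ a n) {z : ℕ → F} (haz : Summable fun n => a n * ‖z n‖) {ε : ℝ} (hε : 0 < ε) :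
    ∃ (J : ℕ) (y : ℕ → X), (∀ n ≥ J, y n = 0) ∧ (Summable fun n => a n * ‖z n - f (y n)‖) ∧
      ∑' n, a n * ‖z n - f (y n)‖ ≤ ε := by
  obtain ⟨J, hJ⟩ := ((tendsto_sum_nat_add fun n => a n * ‖z n‖).eventually_lt_const
    (half_pos hε)).exists
  have exists_approx (n : ℕ) : ∃ y, a n * ‖z n - f y‖ ≤ ε / 2 / (J + 1) := by
    obtain ⟨y, hy⟩ := hf.exists_dist_lt (z n) (ε := ε / 2 / (J + 1) / (a n + 1))
      (by have := ha n; positivity)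
    refine ⟨y, (mul_le_mul_of_nonneg_right (le_add_of_nonneg_right zero_le_one)
      (norm_nonneg _)).trans ?_⟩
    rw [dist_eq_norm, lt_div_iff₀' (by have := ha n; positivity)] at hy
    exact hy.le
  choose y hy using exists_approx
  let y' : ℕ → X := fun n => if n < J then y n else 0
  have y'_tail (n : ℕ) : y' (n + J) = 0 := if_neg (by omega)
  have summable_sub : Summable fun n => a n * ‖z n - f (y' n)‖ := by
    refine (summable_nat_add_iff J).1 ?_
    simpa only [y'_tail, hf0, sub_zero] using (summable_nat_add_iff J).2 haz
  refine ⟨J, y', fun n hn => if_neg hn.not_gt, summable_sub, ?_⟩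
  rw [← summable_sub.sum_add_tsum_nat_add J]
  simp only [y'_tail, hf0, sub_zero]
  have head_le : ∑ n ∈ Finset.range J, a n * ‖z n - f (y' n)‖ ≤ J • (ε / 2 / (J + 1)) := by
    refine (Finset.sum_le_card_nsmul _ _ _ fun n hn => ?_).trans_eq
      (by rw [Finset.card_range])
    rw [show y' n = y n from if_pos (Finset.mem_range.1 hn)]
    exact hy n
  have : J • (ε / 2 / (J + 1)) ≤ ε / 2 := by
    rw [nsmul_eq_mul, mul_div_assoc', div_le_iff₀ (by positivity)]
    linarith
  linarith

variable {k : Type uk} [NontriviallyNormedField k]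

theorem norm_sub_sum_range_le_tsum_mul {E F : Type*} [SeminormedAddCommGroup E] [NormedSpace k E]
    [NormedAddCommGroup F] [NormedSpace k F] {φ : ℕ → StrongDual k E} {y z : ℕ → F} {J : ℕ}
    (hy : ∀ n ≥ J, y n = 0) (hs : Summable fun n => ‖φ n‖ * ‖z n - y n‖) {x : E} {w : F}
    (hw : HasSum (fun n => φ n x • z n) w) :
    ‖w - ∑ n ∈ Finset.range J, φ n x • y n‖ ≤ (∑' n, ‖φ n‖ * ‖z n - y n‖) * ‖x‖ := by
  have hasSum_y : HasSum (fun n => φ n x • y n) (∑ n ∈ Finset.range J, φ n x • y n) :=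
    hasSum_sum_of_ne_finset_zero fun n hn => by rw [hy n (by simpa using hn), smul_zero]
  refine (hw.sub hasSum_y).norm_le_of_bounded (hs.hasSum.mul_right ‖x‖) fun n => ?_
  rw [← smul_sub, norm_smul, mul_right_comm]
  exact mul_le_mul_of_nonneg_right ((φ n).le_opNorm x) (norm_nonneg _)

variable {V : Type u} [AddCommGroup V] [Module k V] [TopologicalSpace V] {p q : Seminorm k V}

theorem IsNuclearOperator.exists_finiteNuclearNormLE [IsTopologicalAddGroup V]
    [ContinuousSMul k V] (hk : ¬ IsUltrametricDist k) (hq : Continuous q) {h : p ≤ q}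
    (hT : IsNuclearOperator (LocalBanach.link h)) :
    ∃ N, ∀ ε > 0, ∃ P : V →L[k] V,
      FiniteNuclearNormLE P q p (N + ε) ∧ ∀ x, p (x - P x) ≤ ε * q x := by
  obtain ⟨φ, z, -, hs, hT⟩ := hT
  specialize hs hk
  refine ⟨∑' n, ‖φ n‖ * ‖z n‖, fun ε hε => ?_⟩
  obtain ⟨J, y, hyJ, hsy, hyε⟩ := exists_eventually_zero_tsum_le_of_denseRange
    (LocalBanach.denseRange_of p) (map_zero _) (fun n => norm_nonneg (φ n)) hs hε
  let ψ (n : ℕ) : V →L[k] k := (φ n).comp (LocalBanach.mk q hq)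
  have norm_ψ_le (n : ℕ) (x : V) : ‖ψ n x‖ ≤ ‖φ n‖ * q x :=
    ((φ n).le_opNorm _).trans_eq (congrArg (‖φ n‖ * ·) (LocalBanach.norm_of q x))
  refine ⟨∑ n : Fin J, (ψ n).smulRight (y n), ⟨Fin J, inferInstance, fun n => ψ n,
    fun n => ‖φ n‖, fun n => y n, fun n => norm_nonneg _, fun n => norm_ψ_le n, ?_, ?_⟩, ?_⟩
  · have seminorm_le (n : ℕ) : ‖φ n‖ * p (y n) ≤
        ‖φ n‖ * ‖z n‖ + ‖φ n‖ * ‖z n - LocalBanach.of p (y n)‖ := by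
      rw [← mul_add, ← LocalBanach.norm_of]
      exact mul_le_mul_of_nonneg_left (norm_le_norm_add_norm_sub _ _) (norm_nonneg _)
    rw [Fin.sum_univ_eq_sum_range (fun n => ‖φ n‖ * p (y n))]
    calc ∑ n ∈ Finset.range J, ‖φ n‖ * p (y n)
        ≤ ∑ n ∈ Finset.range J, (‖φ n‖ * ‖z n‖ + ‖φ n‖ * ‖z n - LocalBanach.of p (y n)‖) :=
          Finset.sum_le_sum fun n _ => seminorm_le n
      _ ≤ ∑' n, (‖φ n‖ * ‖z n‖ + ‖φ n‖ * ‖z n - LocalBanach.of p (y n)‖) :=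
          (hs.add hsy).sum_le_tsum _ fun n _ => by positivity
      _ ≤ _ := (hs.tsum_add hsy).trans_le (add_le_add_right hyε _)
  · intro x
    simp only [sum_apply, ContinuousLinearMap.smulRight_apply]
  · intro x
    have residual_le := norm_sub_sum_range_le_tsum_mul (fun n hn => by rw [hyJ n hn, map_zero]) hsy
      (LocalBanach.link_of h x ▸ hT (LocalBanach.of q x))
    rw [LocalBanach.norm_of] at residual_le
    calc p (x - (∑ n : Fin J, (ψ n).smulRight (y n)) x)
        = ‖LocalBanach.of p x -
            ∑ n ∈ Finset.range J, φ n (LocalBanach.of q x) • LocalBanach.of p (y n)‖ := by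
          rw [← LocalBanach.norm_of, map_sub, ← Fin.sum_univ_eq_sum_range
            (fun n => φ n (LocalBanach.of q x) • LocalBanach.of p (y n))]
          simp only [sum_apply, map_sum, ContinuousLinearMap.smulRight_apply, map_smul]
          rfl
      _ ≤ (∑' n, ‖φ n‖ * ‖z n - LocalBanach.of p (y n)‖) * q x := residual_le
      _ ≤ ε * q x := mul_le_mul_of_nonneg_right hyε (apply_nonneg q x)

/-- On `V` with the seminorms `q` and `p`, the identity from `(V, q)` to `(V, p)` is a limit in
operator norm of finite rank operators of nuclear norm at most one. -/
def NuclearlyDominates (q p : Seminorm k V) : Prop :=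
  ∀ ε > 0, ∃ P : V →L[k] V, FiniteNuclearNormLE P q p 1 ∧ ∀ x, p (x - P x) ≤ ε * q x

theorem NuclearlyDominates.mono {q' : Seminorm k V} (h : NuclearlyDominates q p) (hq : q ≤ q') :
    NuclearlyDominates q' p := fun ε hε => by
  obtain ⟨P, hP, happrox⟩ := h ε hε
  refine ⟨P, ?_, fun x => (happrox x).trans (mul_le_mul_of_nonneg_left (hq x) hε.le)⟩
  simpa only [ContinuousLinearMap.comp_id, mul_one] using
    hP.comp_right (R := .id k V) zero_le_one fun x => (hq x).trans_eq (one_mul _).symm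

theorem IsNuclearOperator.exists_nuclearlyDominates_smul [IsTopologicalAddGroup V]
    [ContinuousSMul k V] (hk : ¬ IsUltrametricDist k) (hq : Continuous q) {h : p ≤ q}
    (hT : IsNuclearOperator (LocalBanach.link h)) :
    ∃ c : NNReal, 1 ≤ c ∧ NuclearlyDominates (c • q) p := by
  obtain ⟨N, hN⟩ := hT.exists_finiteNuclearNormLE hk hq
  let c : NNReal := max 1 (N + 1).toNNReal
  have one_le_c : (1 : ℝ) ≤ c := NNReal.coe_le_coe.2 (le_max_left 1 _)
  have c_pos : (0 : ℝ) < c := one_pos.trans_le one_le_c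
  refine ⟨c, le_max_left _ _, fun ε hε => ?_⟩
  obtain ⟨P, hP, happrox⟩ := hN (min ε 1) (lt_min hε one_pos)
  refine ⟨P, ?_, fun x => (happrox x).trans ?_⟩
  · have rescaled := hP.comp_right (R := .id k V) (q' := c • q) (inv_nonneg.2 c_pos.le)
      fun x => (inv_mul_cancel_left₀ c_pos.ne' (q x)).ge
    refine rescaled.mono ((mul_inv_le_iff₀ c_pos).2 ?_)
    calc N + min ε 1 ≤ N + 1 := by gcongr; exact min_le_right _ _
      _ ≤ (N + 1).toNNReal := Real.le_coe_toNNReal _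
      _ ≤ 1 * c := (NNReal.coe_le_coe.2 (le_max_right _ _)).trans_eq (one_mul _).symm
  · exact mul_le_mul (min_le_left _ _)
      (le_mul_of_one_le_left (apply_nonneg q x) one_le_c)
      (apply_nonneg q x) hε.le

theorem IsNuclearSpace.exists_nuclearlyDominates [IsTopologicalAddGroup V] [ContinuousSMul k V]
    (hV : IsNuclearSpace k V) (hk : ¬ IsUltrametricDist k) (hp : Continuous p)
    (hpa : p.IsAdmissible) :
    ∃ q : Seminorm k V, p ≤ q ∧ Continuous q ∧ q.IsAdmissible ∧ NuclearlyDominates q p := by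
  obtain ⟨q, hpq, hq, hqa, -, hlink⟩ := hV p hp hpa
  obtain ⟨c, hc, hqp⟩ := (hlink hk).exists_nuclearlyDominates_smul hk hq
  exact ⟨c • q, hpq.trans fun x => le_mul_of_one_le_left (apply_nonneg q x) hc,
    continuous_const.mul hq, isAdmissible_smul hqa c, hqp⟩

/-- A sequence of finite rank operators `P n` of nuclear norm at most one from `(V, r (n + 1))` to
`(V, r n)`, approximating the identity up to `δ n`. -/
structure IsApproximatingSequence (r : ℕ → Seminorm k V) (δ : ℕ → NNReal) (P : ℕ → V →L[k] V) :
    Prop where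
  finiteNuclearNormLE : ∀ n, FiniteNuclearNormLE (P n) (r (n + 1)) (r n) 1
  apply_sub_le : ∀ n x, r n (x - P n x) ≤ δ n * r (n + 1) x

variable {r : ℕ → Seminorm k V} {δ : ℕ → NNReal} {P : ℕ → V →L[k] V}

theorem exists_isApproximatingSequence (hr : Monotone r)
    (hdom : ∀ n, NuclearlyDominates (r (n + 1)) (r n)) (hδ0 : δ 0 = 1) (hδ : ∀ n, 0 < δ n) :
    ∃ P : ℕ → V →L[k] V, P 0 = 0 ∧ IsApproximatingSequence r δ P := by
  choose Q hQ hQapprox using fun n => hdom n (δ n) (hδ n)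
  refine ⟨fun n => if n = 0 then 0 else Q n, if_pos rfl, ⟨fun n => ?_, fun n x => ?_⟩⟩
  · cases n with
    | zero => exact .zero zero_le_one
    | succ n => exact hQ (n + 1)
  · cases n with
    | zero => simpa [hδ0] using hr (Nat.le_succ 0) x
    | succ n => exact hQapprox (n + 1) x

variable [IsTopologicalAddGroup V] {E : Type v} [NormedAddCommGroup E] [NormedSpace k E]
  {G : E →L[k] V} {C : ℕ → ℝ}

theorem IsApproximatingSequence.finiteNuclearNormLE_sub_comp (hP : IsApproximatingSequence r δ P)
    (hC0 : ∀ n, 0 ≤ C n) (hC : ∀ n x, r n (G x) ≤ C n * ‖x‖) (n : ℕ) :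
    FiniteNuclearNormLE ((P (n + 1) - P n).comp G) (normSeminorm k E) (r n)
      (δ n * C (n + 2) + δ (n + 1) * C (n + 2)) := by
  have split : (P (n + 1) - P n).comp G =
      (.id k V - P n : V →L[k] V).comp ((P (n + 1)).comp G) -
        (P n).comp ((.id k V - P (n + 1) : V →L[k] V).comp G) := by
    ext x
    simp
  have left_le : FiniteNuclearNormLE ((P (n + 1)).comp G) (normSeminorm k E) (r (n + 1))
      (1 * C (n + 2)) := (hP.finiteNuclearNormLE (n + 1)).comp_right (hC0 _) (hC _)
  have right_le (x : E) : r (n + 1) ((.id k V - P (n + 1) : V →L[k] V).comp G x) ≤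
      δ (n + 1) * C (n + 2) * ‖x‖ :=
    calc r (n + 1) (G x - P (n + 1) (G x)) ≤ δ (n + 1) * r (n + 2) (G x) :=
          hP.apply_sub_le (n + 1) (G x)
      _ ≤ δ (n + 1) * (C (n + 2) * ‖x‖) := mul_le_mul_of_nonneg_left (hC _ x) (δ _).2
      _ = δ (n + 1) * C (n + 2) * ‖x‖ := (mul_assoc ..).symm
  rw [split]
  exact ((left_le.comp_left (δ n).coe_nonneg (hP.apply_sub_le n)).sub <|
    (hP.finiteNuclearNormLE n).comp_right (mul_nonneg (δ _).coe_nonneg (hC0 _)) right_le).mono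
      (by simp only [one_mul, le_refl])

theorem IsApproximatingSequence.tendsto_apply (hP : IsApproximatingSequence r δ P)
    (hr : IsDefiningSequence r) (hC : ∀ n x, r n (G x) ≤ C n * ‖x‖)
    (hδC : Tendsto (fun n => δ n * C (n + 1)) atTop (𝓝 0)) (x : E) :
    Tendsto (fun n => P n (G x)) atTop (𝓝 (G x)) := by
  rw [← tendsto_sub_nhds_zero_iff]
  intro X hX
  change ∀ᶠ n in atTop, P n (G x) - G x ∈ X
  obtain ⟨m, hm⟩ := hr.exists_ball_subset X hX
  have small : ∀ᶠ n in atTop, δ n * C (n + 1) * ‖x‖ < 1 :=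
    (hδC.mul_const ‖x‖).eventually_lt_const (by simp)
  filter_upwards [small, eventually_ge_atTop m] with n hn hmn
  refine hm ?_
  calc r m (P n (G x) - G x) = r m (G x - P n (G x)) := map_sub_rev _ _ _
    _ ≤ r n (G x - P n (G x)) := hr.monotone hmn _
    _ ≤ δ n * r (n + 1) (G x) := hP.apply_sub_le n (G x)
    _ ≤ δ n * (C (n + 1) * ‖x‖) := mul_le_mul_of_nonneg_left (hC _ x) (δ n).2
    _ = δ n * C (n + 1) * ‖x‖ := (mul_assoc ..).symm
    _ < 1 := hn

end NuclearDomination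

theorem IsFN.isNuclearMap_of_not_isUltrametricDist {k : Type uk} [NontriviallyNormedField k]
    (hk : ¬ IsUltrametricDist k) {V : Type u} [AddCommGroup V] [Module k V] [UniformSpace V]
    (hV : IsFN k V) {E : Type v} [NormedAddCommGroup E] [NormedSpace k E] [CompleteSpace E]
    (G : E →L[k] V) : IsNuclearMap G := by
  obtain ⟨⟨_, _, hVc, _, _, _⟩, hVn⟩ := hV
  obtain ⟨r, hr, hdom⟩ := hVc.exists_isDefiningSequence_of_rel
    (R := fun p q => NuclearlyDominates q p) (fun _ _ _ h hq => h.mono hq)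
    fun _ hp hpa => hVn.exists_nuclearlyDominates hk hp hpa
  choose C hC0 hC using fun m => exists_mul_norm_le_of_continuous_seminorm G (hr.continuous m)
  obtain ⟨δ, hδ0, hδ, -, hδC⟩ :=
    exists_weights_summable_mul fun n => add_nonneg (hC0 (n + 1)) (hC0 (n + 2))
  have summable_succ : Summable fun n => δ n * C (n + 1) :=
    hδC.of_nonneg_of_le (fun n => mul_nonneg (δ n).2 (hC0 _)) fun n =>
      mul_le_mul_of_nonneg_left (le_add_of_nonneg_right (hC0 _)) (δ n).2
  have summable_succ_succ : Summable fun n => δ n * C (n + 2) :=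
    hδC.of_nonneg_of_le (fun n => mul_nonneg (δ n).2 (hC0 _)) fun n =>
      mul_le_mul_of_nonneg_left (le_add_of_nonneg_left (hC0 _)) (δ n).2
  obtain ⟨P, hP0, hP⟩ := exists_isApproximatingSequence hr.monotone hdom hδ0 hδ
  obtain ⟨H, hH, hHx⟩ := hr.exists_isNuclearMap_hasSum_of_finiteNuclearNormLE hk
    (hP.finiteNuclearNormLE_sub_comp hC0 hC)
    (summable_succ_succ.add ((summable_nat_add_iff 1).2 summable_succ))
  have telescope (N : ℕ) (x : E) :
      ∑ n ∈ Finset.range N, (P (n + 1) - P n).comp G x = P N (G x) := by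
    simpa [hP0] using Finset.sum_range_sub (fun n => P n (G x)) N
  suffices G = H from this ▸ hH
  ext x
  refine tendsto_nhds_unique
    (hP.tendsto_apply hr hC summable_succ.tendsto_atTop_zero x) ?_
  simpa only [telescope] using (hHx x).tendsto_sum_nat

theorem IsFN.isNuclearMap_of_hasCountableNeighborhoodProperty {k : Type uk}
    [NontriviallyNormedField k] [ProperSpace k] {V : Type u} [AddCommGroup V] [Module k V]
    [UniformSpace V] (hV : IsFN k V) {W : Type v} [AddCommGroup W] [Module k W]
    [TopologicalSpace W] [IsTopologicalAddGroup W] (hW : HasCountableNeighborhoodProperty k W)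
    (g : W →L[k] V) : IsNuclearMap g := by
  obtain ⟨_, _, hVc, _, _, _⟩ := hV.frechet
  obtain ⟨r, hr⟩ := hVc.exists_isDefiningSequence
  obtain ⟨s, hs, G, hsa, rfl⟩ := hW.exists_factorization hr g
  refine IsNuclearMap.comp_right ?_ _
  by_cases hk : IsUltrametricDist k
  · have := LocalBanach.isUltrametricDist hsa
    exact hV.isNuclearMap_of_isUltrametricDist G
  · exact hV.isNuclearMap_of_not_isUltrametricDist hk G

theorem mainTheorem4_general {k : Type uk} [NontriviallyNormedField k] [LocallyCompactSpace k]
    {V : Type u} [AddCommGroup V] [Module k V] [UniformSpace V] (hV : IsFN k V)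
    {U : Type w} [AddCommGroup U] [Module k U] [TopologicalSpace U] [IsTopologicalAddGroup U]
    [ContinuousSMul k U] [FirstCountableTopology U] (hU : IsLocallyConvex k U)
    {W : Type v} [AddCommGroup W] [Module k W] [TopologicalSpace W] (e : W ≃L[k] StrongDual k U) :
    (∀ f : V →L[k] W, IsNuclearMap f) ∧ (∀ g : W →L[k] V, IsNuclearMap g) := by
  have : ProperSpace k := .of_locallyCompactSpace k
  obtain ⟨_, _, hVc, _, _, _⟩ := hV.frechet
  have : IsTopologicalAddGroup W := e.toHomeomorph.isInducing.topologicalAddGroup e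
  exact ⟨isNuclearMap_of_equiv_strongDual hVc hV.nuclear hU e,
    hV.isNuclearMap_of_hasCountableNeighborhoodProperty
      (strongDual_hasCountableNeighborhoodProperty.of_equiv e)⟩

theorem mainTheorem4 (k : Type uk) [NontriviallyNormedField k] (hk : IsLocalFieldCharZero k)
    (V : Type u) [AddCommGroup V] [Module k V] [UniformSpace V] (hV : IsFN k V)
    (W : Type v) [AddCommGroup W] [Module k W] [TopologicalSpace W]
    (hW : IsDFN.{uk, v, w} k W) :
    (∀ f : V →L[k] W, IsNuclearMap f) ∧ (∀ g : W →L[k] V, IsNuclearMap g) := by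
  have := hk.locallyCompact
  obtain ⟨U, _, _, _, ⟨⟨_, _, hU, _, _, _⟩, -⟩, ⟨e⟩⟩ := hW
  exact mainTheorem4_general hV hU e
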